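/- Let $k$ be an algebraically closed field; all algebras are commutative. (1) Let $H$ be a commutative Hopf algebra over $k$, not necessarily of finite type. An $H$-Galois extension of $k$ is a non-zero commutative right $H$-comodule algebra $A=(A,\rho_A)$ (that is, $\rho_A\colon A\to A\otimes_k H$ is a coassociative and counital algebra map) such that $$A\otimes_k A\longrightarrow A\otimes_k H,\qquad a\otimes b\longmapsto a\,\rho_A(b),$$ is an isomorphism. Every $H$-Galois extension $A$ of $k$ is trivial, i.e., it is isomorphic as a right $H$-comodule algebra to $H$ with its comultiplication $\Delta_H\colon H\to H\otimes_k H$ as coaction. (2) In geometric terms, let $G$ be an affine group scheme over $k$, not necessarily of finite type. A $G$-torsor is a non-empty $k$-scheme $X$ (not assumed to be affine) with a right $G$-action such that $X\times_k G\to X\times_k X$, $(x,g)\mapsto(x,xg)$, is an isomorphism. Every $G$-torsor is trivial, i.e., $G$-equivariantly isomorphic over $k$ to $G$ acting on itself by right multiplication. -/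

import Mathlib

universe u v w w'

open scoped TensorProduct

/-- A right `H`-comodule algebra structure on the commutative `k`-algebra `A`: a right coaction
`ρ : A → A ⊗ H`, coassociative and counital, that is an algebra map. -/
structure ComoduleAlgebra (k : Type u) (H : Type v) (A : Type w) [CommRing k]
    [CommRing H] [Bialgebra k H] [CommRing A] [Algebra k A] where
  /-- The structure map `ρ : A → A ⊗ H`. -/
  coact : A →ₐ[k] A ⊗[k] H
  /-- `(ρ ⊗ id) ∘ ρ = (id ⊗ Δ) ∘ ρ`. -/
  coassoc : ∀ a : A,
    Algebra.TensorProduct.assoc k k k A H H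
        (Algebra.TensorProduct.map coact (AlgHom.id k H) (coact a)) =
      Algebra.TensorProduct.map (AlgHom.id k A) (Bialgebra.comulAlgHom k H) (coact a)
  /-- `(id ⊗ ε) ∘ ρ = id`. -/
  counit : ∀ a : A,
    Algebra.TensorProduct.rid k k A
        (Algebra.TensorProduct.map (AlgHom.id k A) (Bialgebra.counitAlgHom k H) (coact a)) = a

namespace ComoduleAlgebra

variable {k : Type u} {H : Type v} {A : Type w} {B : Type w'} [CommRing k]
  [CommRing H] [Bialgebra k H] [CommRing A] [Algebra k A] [CommRing B] [Algebra k B]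

variable (k H) in
/-- `H` as a right comodule algebra over itself, through its comultiplication. -/
noncomputable def regular : ComoduleAlgebra k H H where
  coact := Bialgebra.comulAlgHom k H
  coassoc := Coalgebra.coassoc_apply
  counit a := by
    have h : Algebra.TensorProduct.map (AlgHom.id k H) (Bialgebra.counitAlgHom k H)
        (Bialgebra.comulAlgHom k H a) = a ⊗ₜ[k] (1 : k) :=
      Coalgebra.lTensor_counit_comul a
    rw [h]
    simp

/-- The `A`-linear extension `A ⊗ A → A ⊗ H`, `a ⊗ b ↦ a ρ(b)`, of the coaction. -/
noncomputable def galoisMap (ρ : ComoduleAlgebra k H A) : A ⊗[k] A →ₐ[k] A ⊗[k] H :=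
  Algebra.TensorProduct.productMap Algebra.TensorProduct.includeLeft ρ.coact

/-- `A` is an `H`-Galois extension of the base `k`: it is non-zero, and the map
`A ⊗ A → A ⊗ H`, `a ⊗ b ↦ a ρ(b)`, is bijective. -/
structure IsGaloisExtension (ρ : ComoduleAlgebra k H A) : Prop where
  nontrivial : Nontrivial A
  bijective : Function.Bijective ρ.galoisMap

/-- An isomorphism of right `H`-comodule algebras: an algebra isomorphism `e` that is
`H`-colinear, `ρ_B ∘ e = (e ⊗ id) ∘ ρ_A`. -/
structure Iso (ρA : ComoduleAlgebra k H A) (ρB : ComoduleAlgebra k H B) where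
  toAlgEquiv : A ≃ₐ[k] B
  colinear : ∀ a : A, ρB.coact (toAlgEquiv a) =
    Algebra.TensorProduct.map (toAlgEquiv : A →ₐ[k] B) (AlgHom.id k H) (ρA.coact a)

end ComoduleAlgebra

open CategoryTheory MonoidalCategory CartesianMonoidalCategory

/-- A right action of the monoid object `G` on the object `X`. -/
structure RightActionObj {C : Type u} [Category.{v} C] [CartesianMonoidalCategory C]
    (G : C) [MonObj G] (X : C) where
  /-- The action map `(x, g) ↦ x g`. -/
  act : X ⊗ G ⟶ X
  /-- `x 1 = x`. -/
  act_one : X ◁ MonObj.one ≫ act = (ρ_ X).hom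
  /-- `(x g) h = x (g h)`. -/
  act_mul : act ▷ G ≫ act = (α_ X G G).hom ≫ X ◁ MonObj.mul ≫ act

namespace RightActionObj

variable {C : Type u} [Category.{v} C] [CartesianMonoidalCategory C] {G : C} [MonObj G]

variable (G) in
/-- `G` acting on itself by right multiplication. -/
def regular : RightActionObj G G where
  act := MonObj.mul
  act_one := MonObj.mul_one G
  act_mul := MonObj.mul_assoc G

/-- The map `X × G → X × X`, `(x, g) ↦ (x, x g)`. -/
def shear {X : C} (a : RightActionObj G X) : X ⊗ G ⟶ X ⊗ X := lift (fst X G) a.act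

/-- A `G`-equivariant isomorphism. -/
structure Iso {X Y : C} (a : RightActionObj G X) (b : RightActionObj G Y) where
  toIso : X ≅ Y
  equivariant : a.act ≫ toIso.hom = toIso.hom ▷ G ≫ b.act

end RightActionObj

/-- The `k`-scheme `X`, with its right action of the group scheme `G` over the field `k`, is a
`G`-torsor: `X` is non-empty and `X × G → X × X`, `(x, g) ↦ (x, x g)`, is an isomorphism.
(Since `k` is a field, a non-empty `X` is faithfully flat over `k` and has a point over some
extension field of `k`, so that it is locally isomorphic to `G`.) -/
structure IsTorsor {k : Type u} [Field k] {G : Over (AlgebraicGeometry.Spec (CommRingCat.of k))}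
    [GrpObj G] {X : Over (AlgebraicGeometry.Spec (CommRingCat.of k))}
    (a : RightActionObj G X) : Prop where
  nonempty : Nonempty X.left
  isIso_shear : IsIso a.shear

/-! A rational point `z` of a Galois extension `A` trivialises it: `a ↦ z(a₀) a₁` is colinear, and
after base change from `k` to `A` it becomes the Galois isomorphism followed by translation by an
`A`-valued point of the group, so it is bijective by faithfully flat descent (`bijective_orbit`).
Everything thus rests on finding a point `A → k`.

If `H` is of finite type, so is `A` by descent, and the Nullstellensatz gives a point. In general
`H` is the union of its finitely generated Hopf subalgebras `K` (`exists_fg_mem`), and `A` is the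
union of the subalgebras `A_K = ρ⁻¹(A ⊗ K)`, written `coeffIn K`. The Galois map restricts to `A ⊗
A_K ≅ A ⊗ K` (`bijective_orbitMap_restrict`), so `A_K` has rational points when `K` is finitely
generated. For finitely generated `K ≤ L`, points of `A_K` lift to `A_L`, because a dominant
homomorphism of algebraic groups is surjective on rational points
(`HopfAlgebra.exists_comp_eq_of_injective`).

Surjective transition maps alone do not make an uncountable inverse limit non-empty, so points are
extended by Zorn's lemma over arbitrary Hopf subalgebras `K`. The fibre of `Spec A` over a point of
`A_K` is non-empty, since `1 = 0` there would already follow at a finitely generated level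
(`idealOfPoint_ne_top`). For finitely generated `F`, the image of `A_F` in the functions on that
fibre is a non-zero algebra of finite type and has a point; as `A_{K ⊔ F} = A_K A_F`
(`coeffIn_sup`), the point of `A_K` extends to `A_{K ⊔ F}`. A maximal `K` therefore contains every
`F`.

A torsor `X` is affine by descent: over a non-empty affine open `T` of `X` it becomes `T × G`. The
duality between affine schemes and algebras then turns it into a Galois extension, and a rational
point `x` gives the isomorphism `g ↦ x g`. -/

/-! ### Tensor products of subspaces and subalgebras over a field -/

section TensorOfSubspaces

variable {k M N : Type*} [Field k] [AddCommGroup M] [Module k M] [AddCommGroup N] [Module k N]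

/-- Over a field, `V ⊗ W = (V ⊗ N) ∩ (M ⊗ W)` inside `M ⊗ N`. -/
theorem TensorProduct.mem_range_mapIncl_iff (V : Submodule k M) (W : Submodule k N)
    (x : M ⊗[k] N) :
    x ∈ LinearMap.range (TensorProduct.mapIncl V W) ↔
      x ∈ LinearMap.range (V.subtype.rTensor N) ∧ x ∈ LinearMap.range (W.subtype.lTensor M) := by
  constructor
  · rintro ⟨y, rfl⟩
    constructor
    · exact ⟨W.subtype.lTensor V y, by
        rw [TensorProduct.mapIncl, ← LinearMap.rTensor_comp_lTensor]; rfl⟩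
    · exact ⟨V.subtype.rTensor W y, by
        rw [TensorProduct.mapIncl, ← LinearMap.lTensor_comp_rTensor]; rfl⟩
  · rintro ⟨⟨y, rfl⟩, ⟨z, hz⟩⟩
    obtain ⟨p, hp⟩ := V.subtype.exists_leftInverse_of_injective V.ker_subtype
    obtain ⟨q, hq⟩ := W.subtype.exists_leftInverse_of_injective W.ker_subtype
    refine ⟨TensorProduct.map p q (V.subtype.rTensor N y), ?_⟩
    have h1 : (p.rTensor N) (V.subtype.rTensor N y) = y := by
      rw [← LinearMap.comp_apply, ← LinearMap.rTensor_comp, hp, LinearMap.rTensor_id]; rfl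
    have h2 : (q.lTensor M) (W.subtype.lTensor M z) = z := by
      rw [← LinearMap.comp_apply, ← LinearMap.lTensor_comp, hq, LinearMap.lTensor_id]; rfl
    have h3 : TensorProduct.map p q (V.subtype.rTensor N y) = p.rTensor W z := by
      rw [← LinearMap.rTensor_comp_lTensor, LinearMap.comp_apply, ← hz, h2]
    have h4 : W.subtype.lTensor V (p.rTensor W z) = y := by
      rw [← LinearMap.comp_apply, LinearMap.lTensor_comp_rTensor, ← LinearMap.rTensor_comp_lTensor,
        LinearMap.comp_apply, hz, h1]
    rw [h3, TensorProduct.mapIncl, ← LinearMap.rTensor_comp_lTensor, LinearMap.comp_apply, h4]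

/-- A tensor lies in `M ⊗ W` if and only if its image in `M ⊗ (N / W)` vanishes. -/
theorem TensorProduct.mem_range_lTensor_subtype_iff (W : Submodule k N) (x : M ⊗[k] N) :
    x ∈ LinearMap.range (W.subtype.lTensor M) ↔ W.mkQ.lTensor M x = 0 :=
  ((lTensor_exact M (LinearMap.exact_subtype_mkQ W) W.mkQ_surjective) x).symm

/-- Tensor products over a field commute with kernels. -/
theorem TensorProduct.mem_range_lTensor_ker_iff {P : Type*} [AddCommGroup P] [Module k P]
    (f : N →ₗ[k] P) (x : M ⊗[k] N) :
    x ∈ LinearMap.range ((LinearMap.ker f).subtype.lTensor M) ↔ f.lTensor M x = 0 :=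
  ((Module.Flat.lTensor_exact M f.exact_subtype_ker_map) x).symm

/-- Tensor products over a field commute with kernels. -/
theorem TensorProduct.mem_range_rTensor_ker_iff {P : Type*} [AddCommGroup P] [Module k P]
    (f : M →ₗ[k] P) (x : M ⊗[k] N) :
    x ∈ LinearMap.range ((LinearMap.ker f).subtype.rTensor N) ↔ f.rTensor N x = 0 :=
  ((Module.Flat.rTensor_exact N f.exact_subtype_ker_map) x).symm

end TensorOfSubspaces

section TensorOfSubalgebras

variable {k A B : Type*} [Field k] [CommRing A] [Algebra k A] [CommRing B] [Algebra k B]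

/-- The subalgebra `K ⊗ L` of `A ⊗ B`. -/
noncomputable def Subalgebra.tensor (K : Subalgebra k A) (L : Subalgebra k B) :
    Subalgebra k (A ⊗[k] B) :=
  (Algebra.TensorProduct.map K.val L.val).range

theorem Subalgebra.mem_tensor_iff {K : Subalgebra k A} {L : Subalgebra k B} {x : A ⊗[k] B} :
    x ∈ K.tensor L ↔
      x ∈ LinearMap.range ((Subalgebra.toSubmodule K).subtype.rTensor B) ∧
        x ∈ LinearMap.range ((Subalgebra.toSubmodule L).subtype.lTensor A) :=
  TensorProduct.mem_range_mapIncl_iff (Subalgebra.toSubmodule K) (Subalgebra.toSubmodule L) x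

theorem Subalgebra.mem_top_tensor_iff {L : Subalgebra k B} {x : A ⊗[k] B} :
    x ∈ (⊤ : Subalgebra k A).tensor L ↔
      x ∈ LinearMap.range ((Subalgebra.toSubmodule L).subtype.lTensor A) := by
  rw [mem_tensor_iff, and_iff_right_iff_imp]
  intro _
  have h : Function.Surjective (Subalgebra.toSubmodule (⊤ : Subalgebra k A)).subtype :=
    fun a => ⟨⟨a, trivial⟩, rfl⟩
  exact LinearMap.rTensor_surjective B h x

theorem Subalgebra.tmul_mem_tensor {K : Subalgebra k A} {L : Subalgebra k B} {a : A} {b : B}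
    (ha : a ∈ K) (hb : b ∈ L) : a ⊗ₜ[k] b ∈ K.tensor L :=
  ⟨(⟨a, ha⟩ : K) ⊗ₜ (⟨b, hb⟩ : L), rfl⟩

/-- Induction on elements of `K ⊗ L`. -/
theorem Subalgebra.tensor_induction {K : Subalgebra k A} {L : Subalgebra k B}
    {p : A ⊗[k] B → Prop} (zero : p 0) (tmul : ∀ a ∈ K, ∀ b ∈ L, p (a ⊗ₜ b))
    (add : ∀ x y, p x → p y → p (x + y)) {x : A ⊗[k] B} (hx : x ∈ K.tensor L) : p x := by
  obtain ⟨y, rfl⟩ := hx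
  induction y with
  | zero => exact (map_zero (Algebra.TensorProduct.map K.val L.val)).symm ▸ zero
  | tmul a b => exact tmul a a.2 b b.2
  | add x y hx hy =>
    have := add _ _ hx hy
    rwa [← map_add] at this

theorem Subalgebra.tensor_mono {K K' : Subalgebra k A} {L L' : Subalgebra k B} (h : K ≤ K')
    (h' : L ≤ L') : K.tensor L ≤ K'.tensor L' := fun _ hx =>
  tensor_induction (p := fun x => x ∈ K'.tensor L') (zero_mem _)
    (fun _ ha _ hb => tmul_mem_tensor (h ha) (h' hb)) (fun _ _ => add_mem) hx

theorem Subalgebra.map_val_injective (K : Subalgebra k A) (L : Subalgebra k B) :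
    Function.Injective (Algebra.TensorProduct.map K.val L.val) :=
  TensorProduct.map_injective_of_flat_flat (Subalgebra.toSubmodule K).subtype
    (Subalgebra.toSubmodule L).subtype Subtype.val_injective Subtype.val_injective

/-- `K ⊗ L`, as an abstract tensor product, is the subalgebra `K.tensor L` of `A ⊗ B`. -/
noncomputable def Subalgebra.tensorEquiv (K : Subalgebra k A) (L : Subalgebra k B) :
    K ⊗[k] L ≃ₐ[k] K.tensor L :=
  AlgEquiv.ofInjective (Algebra.TensorProduct.map K.val L.val) (map_val_injective K L)

/-- Corestriction to `K ⊗ L` of a homomorphism with values in `A ⊗ B`. -/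
noncomputable def Subalgebra.codRestrictTensor {C : Type*} [CommRing C] [Algebra k C]
    (K : Subalgebra k A) (L : Subalgebra k B) (f : C →ₐ[k] A ⊗[k] B)
    (hf : ∀ c, f c ∈ K.tensor L) : C →ₐ[k] K ⊗[k] L :=
  (tensorEquiv K L).symm.toAlgHom.comp (f.codRestrict _ hf)

theorem Subalgebra.map_val_codRestrictTensor {C : Type*} [CommRing C] [Algebra k C]
    (K : Subalgebra k A) (L : Subalgebra k B) (f : C →ₐ[k] A ⊗[k] B)
    (hf : ∀ c, f c ∈ K.tensor L) :
    (Algebra.TensorProduct.map K.val L.val).comp (codRestrictTensor K L f hf) = f := by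
  ext c
  exact congrArg Subtype.val ((tensorEquiv K L).apply_symm_apply (f.codRestrict _ hf c))

end TensorOfSubalgebras

/-! ### Hopf subalgebras and convolution -/

section HopfSubalgebra

variable {k : Type u} {H : Type v} [Field k] [CommRing H] [HopfAlgebra k H]

/-- A subalgebra of a commutative Hopf algebra that is closed under the comultiplication and the
antipode. -/
class IsHopfSubalgebra (K : Subalgebra k H) : Prop where
  comul_mem : ∀ h ∈ K, Bialgebra.comulAlgHom k H h ∈ K.tensor K
  antipode_mem : ∀ h ∈ K, HopfAlgebra.antipodeAlgHom k H h ∈ K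

namespace IsHopfSubalgebra

/-- Both conditions place `K` inside the preimage of a subalgebra under an algebra map, so they can
be tested on generators and on the members of a supremum. -/
theorem iff_le {K : Subalgebra k H} : IsHopfSubalgebra K ↔
    K ≤ (K.tensor K).comap (Bialgebra.comulAlgHom k H) ∧
      K ≤ K.comap (HopfAlgebra.antipodeAlgHom k H) :=
  ⟨fun h => ⟨h.1, h.2⟩, fun h => ⟨h.1, h.2⟩⟩

theorem sSup (S : Set (Subalgebra k H)) (hS : ∀ K ∈ S, IsHopfSubalgebra K) :
    IsHopfSubalgebra (sSup S) := by
  rw [iff_le]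
  exact ⟨sSup_le fun K hK => (iff_le.1 (hS K hK)).1.trans
      (fun _ hx => Subalgebra.tensor_mono (le_sSup hK) (le_sSup hK) hx),
    sSup_le fun K hK => (iff_le.1 (hS K hK)).2.trans (fun _ hx => le_sSup hK hx)⟩

theorem sup (K L : Subalgebra k H) [hK : IsHopfSubalgebra K] [hL : IsHopfSubalgebra L] :
    IsHopfSubalgebra (K ⊔ L) := by
  rw [← sSup_pair]
  exact sSup _ (by rintro M (rfl | rfl) <;> assumption)

variable (K : Subalgebra k H) [IsHopfSubalgebra K]

/-- The restricted comultiplication. -/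
noncomputable def comulRestrict : K →ₐ[k] K ⊗[k] K :=
  Subalgebra.codRestrictTensor K K ((Bialgebra.comulAlgHom k H).comp K.val)
    fun h => comul_mem _ h.2

theorem map_comulRestrict (h : K) :
    Algebra.TensorProduct.map K.val K.val (comulRestrict K h) = Bialgebra.comulAlgHom k H h :=
  DFunLike.congr_fun (Subalgebra.map_val_codRestrictTensor K K
    ((Bialgebra.comulAlgHom k H).comp K.val) fun h => comul_mem _ h.2) h

/-- Tensor powers of `K` embed in those of `H` by flatness, and there the axioms become those of
`H`. -/
noncomputable instance : Bialgebra k K :=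
  Bialgebra.ofAlgHom (comulRestrict K) ((Bialgebra.counitAlgHom k H).comp K.val)
    (by
      ext h
      have hinj : Function.Injective (Algebra.TensorProduct.map K.val
          (Algebra.TensorProduct.map K.val K.val)) :=
        TensorProduct.map_injective_of_flat_flat K.val.toLinearMap
          (Algebra.TensorProduct.map K.val K.val).toLinearMap Subtype.val_injective
          (Subalgebra.map_val_injective K K)
      apply hinj
      have e1 : (Algebra.TensorProduct.map K.val (Algebra.TensorProduct.map K.val K.val)).comp
          ((Algebra.TensorProduct.assoc k k k K K K).toAlgHom.comp
            (Algebra.TensorProduct.map (comulRestrict K) (AlgHom.id k K))) =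
          ((Algebra.TensorProduct.assoc k k k H H H).toAlgHom.comp
            (Algebra.TensorProduct.map (Bialgebra.comulAlgHom k H) (AlgHom.id k H))).comp
            (Algebra.TensorProduct.map K.val K.val) := by
        have e3 : (Algebra.TensorProduct.map K.val (Algebra.TensorProduct.map K.val K.val)).comp
            (Algebra.TensorProduct.assoc k k k K K K).toAlgHom =
            (Algebra.TensorProduct.assoc k k k H H H).toAlgHom.comp
              (Algebra.TensorProduct.map (Algebra.TensorProduct.map K.val K.val) K.val) := by
          ext <;> rfl
        rw [← AlgHom.comp_assoc, e3]
        ext x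
        · simp [map_comulRestrict]
        · simp
      have e2 : (Algebra.TensorProduct.map K.val (Algebra.TensorProduct.map K.val K.val)).comp
            (Algebra.TensorProduct.map (AlgHom.id k K) (comulRestrict K)) =
          (Algebra.TensorProduct.map (AlgHom.id k H) (Bialgebra.comulAlgHom k H)).comp
            (Algebra.TensorProduct.map K.val K.val) := by
        ext x
        · simp
        · simp [map_comulRestrict]
      have h1 := DFunLike.congr_fun e1 (comulRestrict K h)
      have h2 := DFunLike.congr_fun e2 (comulRestrict K h)
      have h3 := Coalgebra.coassoc_apply (R := k) (h : H)
      refine (h1.trans ?_).trans h2.symm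
      rw [AlgHom.comp_apply, AlgHom.comp_apply, AlgHom.comp_apply, map_comulRestrict]
      exact h3)
    (by
      ext h
      apply Module.Flat.lTensor_preserves_injective_linearMap (M := k) K.val.toLinearMap
        Subtype.val_injective
      have e : (Algebra.TensorProduct.map (AlgHom.id k k) K.val).comp
          (Algebra.TensorProduct.map ((Bialgebra.counitAlgHom k H).comp K.val) (AlgHom.id k K)) =
          (Algebra.TensorProduct.map (Bialgebra.counitAlgHom k H) (AlgHom.id k H)).comp
            (Algebra.TensorProduct.map K.val K.val) := by
        ext x <;> simp
      refine (DFunLike.congr_fun e (comulRestrict K h)).trans ?_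
      rw [AlgHom.comp_apply, map_comulRestrict]
      exact Coalgebra.rTensor_counit_comul (R := k) (h : H))
    (by
      ext h
      apply Module.Flat.rTensor_preserves_injective_linearMap (M := k) K.val.toLinearMap
        Subtype.val_injective
      have e : (Algebra.TensorProduct.map K.val (AlgHom.id k k)).comp
          (Algebra.TensorProduct.map (AlgHom.id k K) ((Bialgebra.counitAlgHom k H).comp K.val)) =
          (Algebra.TensorProduct.map (AlgHom.id k H) (Bialgebra.counitAlgHom k H)).comp
            (Algebra.TensorProduct.map K.val K.val) := by
        ext x <;> simp
      refine (DFunLike.congr_fun e (comulRestrict K h)).trans ?_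
      rw [AlgHom.comp_apply, map_comulRestrict]
      exact Coalgebra.lTensor_counit_comul (R := k) (h : H))

theorem map_val_comul (h : K) :
    Algebra.TensorProduct.map K.val K.val (Bialgebra.comulAlgHom k K h) =
      Bialgebra.comulAlgHom k H h :=
  map_comulRestrict K h

/-- The restricted antipode. -/
noncomputable def antipodeRestrict : K →ₐ[k] K :=
  ((HopfAlgebra.antipodeAlgHom k H).comp K.val).codRestrict K fun h => antipode_mem _ h.2

theorem val_antipodeRestrict (h : K) :
    (antipodeRestrict K h : H) = HopfAlgebra.antipode k (h : H) := rfl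

noncomputable instance : HopfAlgebra k K :=
  HopfAlgebra.ofAlgHom (antipodeRestrict K)
    (by
      ext h
      have e : K.val.comp (Algebra.TensorProduct.lift (antipodeRestrict K) (AlgHom.id k K)
            fun _ _ => Commute.all _ _) =
          (Algebra.TensorProduct.lift (HopfAlgebra.antipodeAlgHom k H) (AlgHom.id k H)
            fun _ _ => Commute.all _ _).comp (Algebra.TensorProduct.map K.val K.val) := by
        ext x
        · simp [val_antipodeRestrict]
        · simp
      refine (DFunLike.congr_fun e (Bialgebra.comulAlgHom k K h)).trans ?_
      rw [AlgHom.comp_apply, map_val_comul]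
      have h1 := congrArg (fun f => f.ofConv (h : H)) (AlgHom.antipode_id_cancel (R := k) (A := H))
      rw [AlgHom.convMul_apply] at h1
      exact h1)
    (by
      ext h
      have e : K.val.comp (Algebra.TensorProduct.lift (AlgHom.id k K) (antipodeRestrict K)
            fun _ _ => Commute.all _ _) =
          (Algebra.TensorProduct.lift (AlgHom.id k H) (HopfAlgebra.antipodeAlgHom k H)
            fun _ _ => Commute.all _ _).comp (Algebra.TensorProduct.map K.val K.val) := by
        ext x
        · simp
        · simp [val_antipodeRestrict]
      refine (DFunLike.congr_fun e (Bialgebra.comulAlgHom k K h)).trans ?_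
      rw [AlgHom.comp_apply, map_val_comul]
      have h1 := congrArg (fun f => f.ofConv (h : H))
        (mul_inv_cancel (WithConv.toConv (AlgHom.id k H)))
      rw [AlgHom.convMul_apply] at h1
      exact h1)

/-- The inclusion of Hopf subalgebras, as a homomorphism of bialgebras. -/
noncomputable def inclusion {K L : Subalgebra k H} [IsHopfSubalgebra K] [IsHopfSubalgebra L]
    (h : K ≤ L) : K →ₐc[k] L :=
  BialgHom.ofAlgHom (Subalgebra.inclusion h) (by ext; rfl) (by
    ext x
    apply Subalgebra.map_val_injective L L
    have e : (Algebra.TensorProduct.map L.val L.val).comp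
        (Algebra.TensorProduct.map (Subalgebra.inclusion h) (Subalgebra.inclusion h)) =
        Algebra.TensorProduct.map K.val K.val := by
      ext <;> rfl
    refine (DFunLike.congr_fun e (Bialgebra.comulAlgHom k K x)).trans ?_
    rw [map_val_comul]
    exact (map_val_comul L (Subalgebra.inclusion h x)).symm)

end IsHopfSubalgebra

section Convolution

variable {C : Type*} [CommRing C] [Algebra k C]

/-- Composition with `f` respects convolution and carries `S * id = 1` to this identity: points of
the group are inverted by the antipode. -/
theorem AlgHom.toConv_comp_antipode_mul (f : H →ₐ[k] C) :
    WithConv.toConv (f.comp (HopfAlgebra.antipodeAlgHom k H)) * WithConv.toConv f = 1 := by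
  have h := AlgHom.comp_convMul_distrib f
    (WithConv.toConv (HopfAlgebra.antipodeAlgHom k H)) (WithConv.toConv (AlgHom.id k H))
  rw [AlgHom.antipode_id_cancel] at h
  rw [WithConv.ext_iff]
  refine Eq.trans (Eq.trans ?_ h.symm) ?_
  · rfl
  · ext x
    exact f.commutes _

theorem AlgHom.toConv_mul_comp_antipode (f : H →ₐ[k] C) :
    WithConv.toConv f * WithConv.toConv (f.comp (HopfAlgebra.antipodeAlgHom k H)) = 1 := by
  have h := AlgHom.comp_convMul_distrib f
    (WithConv.toConv (AlgHom.id k H)) (WithConv.toConv (HopfAlgebra.antipodeAlgHom k H))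
  have h0 := mul_inv_cancel (WithConv.toConv (AlgHom.id k H))
  change WithConv.toConv (AlgHom.id k H) * WithConv.toConv (HopfAlgebra.antipodeAlgHom k H) = 1
    at h0
  rw [h0] at h
  rw [WithConv.ext_iff]
  refine Eq.trans (Eq.trans ?_ h.symm) ?_
  · rfl
  · ext x
    exact f.commutes _

end Convolution

/-- The comultiplication of `S h` is `S h₂ ⊗ S h₁`. -/
theorem HopfAlgebra.comul_antipodeAlgHom (h : H) :
    Bialgebra.comulAlgHom k H (antipodeAlgHom k H h) =
      Algebra.TensorProduct.lift
        (Algebra.TensorProduct.includeRight.comp (antipodeAlgHom k H))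
        ((Algebra.TensorProduct.includeLeft : H →ₐ[k] H ⊗[k] H).comp (antipodeAlgHom k H))
        (fun _ _ => Commute.all _ _) (Bialgebra.comulAlgHom k H h) := by
  have h1 : WithConv.toConv (Algebra.TensorProduct.includeLeft : H →ₐ[k] H ⊗[k] H) *
        WithConv.toConv Algebra.TensorProduct.includeRight =
      WithConv.toConv (Bialgebra.comulAlgHom k H) := by
    ext x
    rw [AlgHom.convMul_apply]
    have : Algebra.TensorProduct.lift (Algebra.TensorProduct.includeLeft : H →ₐ[k] H ⊗[k] H)
      Algebra.TensorProduct.includeRight (fun _ _ => Commute.all _ _) = AlgHom.id k _ := by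
      ext <;> simp
    exact DFunLike.congr_fun this _
  -- `Δ` is the convolution product of the two inclusions `i₁ * i₂`. Its left inverse `Δ ∘ S` equals
  -- its right inverse `(i₂ ∘ S) * (i₁ ∘ S)`.
  have h2 := left_inv_eq_right_inv (AlgHom.toConv_comp_antipode_mul (Bialgebra.comulAlgHom k H))
    (c := WithConv.toConv ((Algebra.TensorProduct.includeRight : H →ₐ[k] H ⊗[k] H).comp
        (antipodeAlgHom k H)) *
      WithConv.toConv ((Algebra.TensorProduct.includeLeft : H →ₐ[k] H ⊗[k] H).comp
        (antipodeAlgHom k H))) (by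
      rw [← h1, mul_assoc, ← mul_assoc (WithConv.toConv Algebra.TensorProduct.includeRight),
        AlgHom.toConv_mul_comp_antipode, one_mul, AlgHom.toConv_mul_comp_antipode])
  have h3 := congrArg (fun f => f.ofConv h) h2
  dsimp only at h3
  rw [AlgHom.convMul_apply] at h3
  exact h3

end HopfSubalgebra

/-! ### Slices of tensors and finite-dimensional subcoalgebras -/

section Slices

variable {k M N : Type*} [Field k] [AddCommGroup M] [Module k M] [AddCommGroup N] [Module k N]

/-- Contraction of the second factor with a linear form. -/
noncomputable def TensorProduct.sliceRight (ψ : N →ₗ[k] k) : M ⊗[k] N →ₗ[k] M :=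
  (TensorProduct.rid k M).toLinearMap ∘ₗ ψ.lTensor M

/-- Contraction of the first factor with a linear form. -/
noncomputable def TensorProduct.sliceLeft (φ : M →ₗ[k] k) : M ⊗[k] N →ₗ[k] N :=
  (TensorProduct.lid k N).toLinearMap ∘ₗ φ.rTensor N

@[simp] theorem TensorProduct.sliceRight_tmul (ψ : N →ₗ[k] k) (m : M) (n : N) :
    sliceRight ψ (m ⊗ₜ[k] n) = ψ n • m := by simp [sliceRight]

@[simp] theorem TensorProduct.sliceLeft_tmul (φ : M →ₗ[k] k) (m : M) (n : N) :
    sliceLeft φ (m ⊗ₜ[k] n) = φ m • n := by simp [sliceLeft]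

/-- The coefficients of `x` in a basis of `N` are its slices by the coordinate forms. -/
theorem TensorProduct.eq_zero_of_sliceRight {x : M ⊗[k] N}
    (h : ∀ ψ : N →ₗ[k] k, sliceRight ψ x = 0) : x = 0 := by
  classical
  let b := Module.Basis.ofVectorSpace k N
  apply (TensorProduct.equivFinsuppOfBasisRight (M := M) b).injective
  rw [map_zero]
  ext i
  rw [Finsupp.zero_apply, ← h (b.coord i)]
  clear h
  induction x with
  | zero => simp
  | tmul m n => simp
  | add x y hx hy => rw [map_add, Finsupp.add_apply, hx, hy, map_add]

/-- Slicing commutes with reduction modulo `V`, so the image of `x` in `(M / V) ⊗ N` has only zero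
slices. -/
theorem TensorProduct.mem_range_rTensor_of_sliceRight {V : Submodule k M} {x : M ⊗[k] N}
    (h : ∀ ψ : N →ₗ[k] k, sliceRight ψ x ∈ V) : x ∈ LinearMap.range (V.subtype.rTensor N) := by
  rw [← V.ker_mkQ, TensorProduct.mem_range_rTensor_ker_iff]
  refine eq_zero_of_sliceRight fun ψ => ?_
  have e : sliceRight ψ ∘ₗ V.mkQ.rTensor N = V.mkQ ∘ₗ sliceRight ψ := by
    ext m n; simp
  rw [← LinearMap.comp_apply, e, LinearMap.comp_apply, V.mkQ_apply,
    Submodule.Quotient.mk_eq_zero]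
  exact h ψ

theorem TensorProduct.mem_range_lTensor_of_sliceLeft {W : Submodule k N} {x : M ⊗[k] N}
    (h : ∀ φ : M →ₗ[k] k, sliceLeft φ x ∈ W) : x ∈ LinearMap.range (W.subtype.lTensor M) := by
  have h1 : TensorProduct.comm k M N x ∈ LinearMap.range (W.subtype.rTensor M) := by
    refine mem_range_rTensor_of_sliceRight fun φ => ?_
    have e : sliceRight φ ∘ₗ (TensorProduct.comm k M N).toLinearMap = sliceLeft φ := by
      ext m n; simp
    exact (DFunLike.congr_fun e x).symm ▸ h φ
  obtain ⟨y, hy⟩ := h1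
  refine ⟨TensorProduct.comm k W M y, ?_⟩
  apply (TensorProduct.comm k M N).injective
  rw [← hy]
  have e : (TensorProduct.comm k M N).toLinearMap ∘ₗ W.subtype.lTensor M ∘ₗ
      (TensorProduct.comm k W M).toLinearMap = W.subtype.rTensor M := by
    ext m n; simp
  exact DFunLike.congr_fun e y

theorem TensorProduct.exists_fg_sliceLeft_mem (x : M ⊗[k] N) :
    ∃ W : Submodule k N, W.FG ∧ ∀ φ : M →ₗ[k] k, sliceLeft φ x ∈ W := by
  induction x with
  | zero => exact ⟨⊥, Submodule.fg_bot, fun φ => by simp⟩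
  | tmul m n =>
    exact ⟨Submodule.span k {n}, Submodule.fg_span_singleton n, fun φ => by
      simpa using Submodule.smul_mem _ _ (Submodule.mem_span_singleton_self n)⟩
  | add x y hx hy =>
    obtain ⟨V, hV, h1⟩ := hx
    obtain ⟨W, hW, h2⟩ := hy
    exact ⟨V ⊔ W, hV.sup hW, fun φ => by
      rw [map_add]; exact Submodule.add_mem_sup (h1 φ) (h2 φ)⟩

theorem TensorProduct.exists_fg_sliceRight_mem (x : M ⊗[k] N) :
    ∃ W : Submodule k M, W.FG ∧ ∀ ψ : N →ₗ[k] k, sliceRight ψ x ∈ W := by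
  obtain ⟨W, hW, h⟩ := exists_fg_sliceLeft_mem (TensorProduct.comm k M N x)
  refine ⟨W, hW, fun ψ => ?_⟩
  have e : sliceLeft ψ ∘ₗ (TensorProduct.comm k M N).toLinearMap = sliceRight ψ := by
    ext m n; simp
  exact DFunLike.congr_fun e x ▸ h ψ

end Slices

section Translates

variable {k C : Type*} [Field k] [AddCommGroup C] [Module k C] [Coalgebra k C]

open Coalgebra TensorProduct

/-- The action `c ↦ c₁ ψ(c₂)` of a linear form on a coalgebra. -/
noncomputable def Coalgebra.actRight (ψ : C →ₗ[k] k) : C →ₗ[k] C := sliceRight ψ ∘ₗ comul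

/-- The action `c ↦ φ(c₁) c₂` of a linear form on a coalgebra. -/
noncomputable def Coalgebra.actLeft (φ : C →ₗ[k] k) : C →ₗ[k] C := sliceLeft φ ∘ₗ comul

theorem Coalgebra.actRight_counit (c : C) : actRight (counit (R := k)) c = c := by
  simp [actRight, sliceRight]

theorem Coalgebra.actLeft_counit (c : C) : actLeft (counit (R := k)) c = c := by
  simp [actLeft, sliceLeft]

/-- Coassociativity makes the dual of `C` an algebra acting on `C` from both sides by commuting
actions. Hence the span of all two-sided translates of `c` is stable. -/
theorem Coalgebra.actRight_actRight (φ ψ : C →ₗ[k] k) (c : C) :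
    actRight φ (actRight ψ c) =
      actRight (LinearMap.mul' k k ∘ₗ _root_.TensorProduct.map φ ψ ∘ₗ comul) c := by
  have e1 : actRight φ ∘ₗ sliceRight ψ =
      (sliceRight (LinearMap.mul' k k ∘ₗ _root_.TensorProduct.map φ ψ)) ∘ₗ
        (_root_.TensorProduct.assoc k C C C).toLinearMap ∘ₗ comul.rTensor C := by
    refine _root_.TensorProduct.ext' fun x y => ?_
    simp only [actRight, LinearMap.comp_apply,
      sliceRight_tmul, map_smul, LinearMap.rTensor_tmul, LinearEquiv.coe_coe]
    generalize comul (R := k) x = z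
    induction z with
    | zero => simp
    | tmul a b => simp [smul_smul, mul_comm]
    | add a b ha hb => simp only [map_add, smul_add, add_tmul, ha, hb]
  have e2 : sliceRight (M := C) (LinearMap.mul' k k ∘ₗ _root_.TensorProduct.map φ ψ) ∘ₗ comul.lTensor C =
      sliceRight (LinearMap.mul' k k ∘ₗ _root_.TensorProduct.map φ ψ ∘ₗ comul) := by
    ext x y
    simp
  have h := coassoc_apply (R := k) c
  calc _ = (actRight φ ∘ₗ sliceRight ψ) (comul c) := rfl
    _ = _ := by
      rw [e1]
      change sliceRight _ (_root_.TensorProduct.assoc k C C C (comul.rTensor C (comul c))) = _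
      rw [h, ← LinearMap.comp_apply, e2]
      rfl

theorem Coalgebra.actLeft_actLeft (φ ψ : C →ₗ[k] k) (c : C) :
    actLeft φ (actLeft ψ c) =
      actLeft (LinearMap.mul' k k ∘ₗ _root_.TensorProduct.map ψ φ ∘ₗ comul) c := by
  have e1 : actLeft φ ∘ₗ sliceLeft ψ =
      (sliceLeft (LinearMap.mul' k k ∘ₗ _root_.TensorProduct.map ψ φ)) ∘ₗ
        (_root_.TensorProduct.assoc k C C C).symm.toLinearMap ∘ₗ comul.lTensor C := by
    refine _root_.TensorProduct.ext' fun x y => ?_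
    simp only [actLeft, LinearMap.comp_apply,
      sliceLeft_tmul, map_smul, LinearMap.lTensor_tmul, LinearEquiv.coe_coe]
    generalize comul (R := k) y = z
    induction z with
    | zero => simp
    | tmul a b => simp [smul_smul]
    | add a b ha hb => simp only [map_add, smul_add, tmul_add, ha, hb]
  have e2 : sliceLeft (N := C) (LinearMap.mul' k k ∘ₗ _root_.TensorProduct.map ψ φ) ∘ₗ comul.rTensor C =
      sliceLeft (LinearMap.mul' k k ∘ₗ _root_.TensorProduct.map ψ φ ∘ₗ comul) := by
    ext x y
    simp
  have h := coassoc_symm_apply (R := k) c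
  calc _ = (actLeft φ ∘ₗ sliceLeft ψ) (comul c) := rfl
    _ = _ := by
      rw [e1]
      change sliceLeft _ ((_root_.TensorProduct.assoc k C C C).symm (comul.lTensor C (comul c))) = _
      rw [h, ← LinearMap.comp_apply, e2]
      rfl

theorem Coalgebra.actRight_actLeft (φ ψ : C →ₗ[k] k) (c : C) :
    actRight ψ (actLeft φ c) = actLeft φ (actRight ψ c) := by
  have e1 : actRight ψ ∘ₗ sliceLeft φ =
      sliceLeft φ ∘ₗ (sliceRight ψ).lTensor C ∘ₗ comul.lTensor C := by
    ext x y
    simp [actRight]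
  have e2 : actLeft φ ∘ₗ sliceRight ψ =
      sliceLeft φ ∘ₗ (sliceRight ψ).lTensor C ∘ₗ (_root_.TensorProduct.assoc k C C C).toLinearMap ∘ₗ
        comul.rTensor C := by
    refine _root_.TensorProduct.ext' fun x y => ?_
    simp only [actLeft, LinearMap.comp_apply,
      sliceRight_tmul, map_smul, LinearMap.rTensor_tmul, LinearEquiv.coe_coe]
    generalize comul (R := k) x = z
    induction z with
    | zero => simp
    | tmul a b => simp [smul_smul, mul_comm]
    | add a b ha hb => simp only [map_add, smul_add, add_tmul, ha, hb]
  calc _ = (actRight ψ ∘ₗ sliceLeft φ) (comul c) := rfl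
    _ = (actLeft φ ∘ₗ sliceRight ψ) (comul c) := by
      rw [e1, e2]
      change sliceLeft φ ((sliceRight ψ).lTensor C _) =
        sliceLeft φ ((sliceRight ψ).lTensor C
          (_root_.TensorProduct.assoc k C C C (comul.rTensor C (comul c))))
      rw [coassoc_apply]
    _ = _ := rfl

/-- The fundamental theorem of coalgebras: every element lies in a finite-dimensional
subcoalgebra. -/
theorem Coalgebra.exists_fg_stable (c : C) :
    ∃ V : Submodule k C, V.FG ∧ c ∈ V ∧ (∀ ψ : C →ₗ[k] k, ∀ v ∈ V, actRight ψ v ∈ V) ∧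
      (∀ φ : C →ₗ[k] k, ∀ v ∈ V, actLeft φ v ∈ V) ∧
      ∀ W : Submodule k C, c ∈ W → (∀ ψ : C →ₗ[k] k, ∀ v ∈ W, actRight ψ v ∈ W) →
        (∀ φ : C →ₗ[k] k, ∀ v ∈ W, actLeft φ v ∈ W) → V ≤ W := by
  -- The span of the two-sided translates is the smallest stable subspace containing `c`; minimality
  -- later keeps it inside a given Hopf subalgebra.
  refine ⟨Submodule.span k {x | ∃ φ ψ : C →ₗ[k] k, actLeft φ (actRight ψ c) = x}, ?_,
    Submodule.subset_span ⟨counit, counit, by rw [actRight_counit, actLeft_counit]⟩,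
    fun χ v hv => ?_, fun χ v hv => ?_, fun W hc hR hL => Submodule.span_le.2 ?_⟩
  · obtain ⟨V, hV, h⟩ := exists_fg_sliceRight_mem (comul (R := k) c)
    obtain ⟨s, rfl⟩ := hV
    choose W hW h' using fun x : C => exists_fg_sliceLeft_mem (comul (R := k) x)
    have hfg : (⨆ x ∈ s, W x).FG := Submodule.fg_biSup s W fun x _ => hW x
    refine Submodule.FG.of_le hfg (Submodule.span_le.2 ?_)
    rintro _ ⟨φ, ψ, rfl⟩
    suffices ∀ v ∈ Submodule.span k (s : Set C), actLeft φ v ∈ ⨆ x ∈ s, W x from this _ (h ψ)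
    intro v hv
    induction hv using Submodule.span_induction with
    | mem x hx => exact Submodule.mem_iSup_of_mem x (Submodule.mem_iSup_of_mem hx (h' x φ))
    | zero => simp
    | add x y _ _ hx hy => rw [map_add]; exact add_mem hx hy
    | smul a x _ hx => rw [map_smul]; exact Submodule.smul_mem _ _ hx
  · induction hv using Submodule.span_induction with
    | mem x hx =>
      obtain ⟨φ, ψ, rfl⟩ := hx
      rw [actRight_actLeft, actRight_actRight]
      exact Submodule.subset_span ⟨_, _, rfl⟩
    | zero => simp
    | add x y _ _ hx hy => rw [map_add]; exact add_mem hx hy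
    | smul a x _ hx => rw [map_smul]; exact Submodule.smul_mem _ _ hx
  · induction hv using Submodule.span_induction with
    | mem x hx =>
      obtain ⟨φ, ψ, rfl⟩ := hx
      rw [actLeft_actLeft]
      exact Submodule.subset_span ⟨_, _, rfl⟩
    | zero => simp
    | add x y _ _ hx hy => rw [map_add]; exact add_mem hx hy
    | smul a x _ hx => rw [map_smul]; exact Submodule.smul_mem _ _ hx
  · rintro _ ⟨φ, ψ, rfl⟩
    exact hL _ _ (hR _ _ hc)

end Translates

/-! ### Local finiteness of commutative Hopf algebras -/

section LocalFiniteness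

variable {k : Type u} {H : Type v} [Field k] [CommRing H] [HopfAlgebra k H]

/-- Since `S` is an algebra map, `S ∘ S` is a convolution inverse of `S`, and so is the identity. -/
theorem HopfAlgebra.antipodeAlgHom_antipodeAlgHom (h : H) :
    antipodeAlgHom k H (antipodeAlgHom k H h) = h := by
  have h1 := left_inv_eq_right_inv
    (AlgHom.toConv_comp_antipode_mul (antipodeAlgHom k H))
    (c := WithConv.toConv (AlgHom.id k H)) AlgHom.antipode_id_cancel
  exact congrArg (fun f => f.ofConv h) h1

open TensorProduct Coalgebra

namespace IsHopfSubalgebra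

/-- Stability under both actions gives `Δ(V) ⊆ V ⊗ V`. As `S` reverses `Δ` and is an involution, the
generators `V ∪ S(V)` satisfy both closure conditions. -/
theorem adjoin_union_antipode (V : Submodule k H) (hR : ∀ ψ : H →ₗ[k] k, ∀ v ∈ V, actRight ψ v ∈ V)
    (hL : ∀ φ : H →ₗ[k] k, ∀ v ∈ V, actLeft φ v ∈ V) :
    IsHopfSubalgebra (Algebra.adjoin k
      (V ∪ HopfAlgebra.antipodeAlgHom k H '' V : Set H)) := by
  set K := Algebra.adjoin k (V ∪ HopfAlgebra.antipodeAlgHom k H '' V : Set H) with hK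
  have hV : ∀ v ∈ V, v ∈ K := fun v hv => Algebra.subset_adjoin (Or.inl hv)
  have hSV : ∀ v ∈ V, HopfAlgebra.antipodeAlgHom k H v ∈ K :=
    fun v hv => Algebra.subset_adjoin (Or.inr ⟨v, hv, rfl⟩)
  have hΔ : ∀ v ∈ V, comul (R := k) v ∈ LinearMap.range (mapIncl V V) := fun v hv =>
    (mem_range_mapIncl_iff V V _).2 ⟨mem_range_rTensor_of_sliceRight fun ψ => hR ψ v hv,
      mem_range_lTensor_of_sliceLeft fun φ => hL φ v hv⟩
  rw [iff_le, hK, Algebra.adjoin_le_iff, Algebra.adjoin_le_iff, ← hK]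
  constructor
  · rintro x (hx | ⟨x, hx, rfl⟩)
    · obtain ⟨y, hy⟩ := hΔ x hx
      change comul (R := k) x ∈ K.tensor K
      rw [← hy]
      clear hy
      induction y with
      | zero => rw [map_zero]; exact zero_mem _
      | tmul a b => exact Subalgebra.tmul_mem_tensor (hV a a.2) (hV b b.2)
      | add a b ha hb => rw [map_add]; exact add_mem ha hb
    · obtain ⟨y, hy⟩ := hΔ x hx
      change Bialgebra.comulAlgHom k H (HopfAlgebra.antipodeAlgHom k H x) ∈ K.tensor K
      rw [HopfAlgebra.comul_antipodeAlgHom, Bialgebra.comulAlgHom_apply, ← hy]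
      clear hy
      induction y with
      | zero => rw [map_zero, map_zero]; exact zero_mem _
      | tmul a b =>
        have := Subalgebra.tmul_mem_tensor (hSV b b.2) (hSV a a.2)
        simpa [mapIncl] using this
      | add a b ha hb => rw [map_add, map_add]; exact add_mem ha hb
  · rintro x (hx | ⟨x, hx, rfl⟩)
    · exact hSV x hx
    · change HopfAlgebra.antipodeAlgHom k H (HopfAlgebra.antipodeAlgHom k H x) ∈ K
      rw [HopfAlgebra.antipodeAlgHom_antipodeAlgHom]
      exact hV x hx

/-- A commutative Hopf algebra is the union of its finitely generated Hopf subalgebras. -/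
theorem exists_fg_mem (K : Subalgebra k H) [IsHopfSubalgebra K] {h : H} (hh : h ∈ K) :
    ∃ L ≤ K, IsHopfSubalgebra L ∧ L.FG ∧ h ∈ L := by
  obtain ⟨V, hV, hhV, hR, hL, hmin⟩ := Coalgebra.exists_fg_stable (k := k) h
  have hVK : V ≤ Subalgebra.toSubmodule K := by
    refine hmin _ hh (fun ψ v hv => ?_) fun φ v hv => ?_
    · obtain ⟨y, hy⟩ := comul_mem v hv
      have : actRight ψ v = sliceRight ψ (Bialgebra.comulAlgHom k H v) := rfl
      rw [this, ← hy]
      clear hy this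
      induction y with
      | zero => simp
      | tmul a b => simpa using K.smul_mem a.2 (ψ b)
      | add a b ha hb => rw [map_add, map_add]; exact add_mem ha hb
    · obtain ⟨y, hy⟩ := comul_mem v hv
      have : actLeft φ v = sliceLeft φ (Bialgebra.comulAlgHom k H v) := rfl
      rw [this, ← hy]
      clear hy this
      induction y with
      | zero => simp
      | tmul a b => simpa using K.smul_mem b.2 (φ a)
      | add a b ha hb => rw [map_add, map_add]; exact add_mem ha hb
  refine ⟨_, ?_, adjoin_union_antipode V hR hL, ?_, Algebra.subset_adjoin (Or.inl hhV)⟩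
  · rw [Algebra.adjoin_le_iff]
    rintro x (hx | ⟨x, hx, rfl⟩)
    · exact hVK hx
    · exact antipode_mem _ (hVK hx)
  · rw [Algebra.adjoin_union]
    obtain ⟨s, hs⟩ := hV
    have h1 : Algebra.adjoin k (V : Set H) = Algebra.adjoin k (s : Set H) := by
      rw [← hs, Algebra.adjoin_span]
    have h2 : Algebra.adjoin k (HopfAlgebra.antipodeAlgHom k H '' V) =
        (Algebra.adjoin k (V : Set H)).map (HopfAlgebra.antipodeAlgHom k H) :=
      (AlgHom.map_adjoin _ _).symm
    have h3 : (Algebra.adjoin k (V : Set H)).FG := ⟨s, h1.symm⟩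
    rw [h2]
    exact h3.sup (h3.map _)

end IsHopfSubalgebra

end LocalFiniteness

/-! ### Translations by points of the group -/

section Translation

variable {k : Type u} {K : Type v} {L : Type w} [Field k] [CommRing K] [HopfAlgebra k K]
  [CommRing L] [Algebra k L]

open Algebra.TensorProduct WithConv

/-- The map `h ↦ g(h₁) ⊗ h₂`: functions on the group, translated by the point `g`. -/
noncomputable def HopfAlgebra.translate (g : K →ₐ[k] L) : K →ₐ[k] L ⊗[k] K :=
  (map g (AlgHom.id k K)).comp (Bialgebra.comulAlgHom k K)

theorem HopfAlgebra.toConv_translate (g : K →ₐ[k] L) :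
    toConv (HopfAlgebra.translate g) =
      toConv ((includeLeft : L →ₐ[k] L ⊗[k] K).comp g) * toConv includeRight := by
  ext x
  rw [AlgHom.convMul_apply]
  have : Algebra.TensorProduct.lift ((includeLeft : L →ₐ[k] L ⊗[k] K).comp g)
      includeRight (fun _ _ => Commute.all _ _) = map g (AlgHom.id k K) := by
    ext <;> simp
  exact (DFunLike.congr_fun this _).symm

/-- Translation by `g` is the convolution of `g` with the inclusion of `K`. On the factor `K` the
composite is therefore `g * g'` times that inclusion. -/
theorem HopfAlgebra.productMap_translate_comp {g g' : K →ₐ[k] L}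
    (h : toConv g * toConv g' = 1) :
    (productMap includeLeft (translate g')).comp (productMap includeLeft (translate g)) =
      AlgHom.id k (L ⊗[k] K) := by
  apply Algebra.TensorProduct.ext
  · ext x; simp
  · have h1 := AlgHom.comp_convMul_distrib (productMap includeLeft (translate g'))
      (toConv ((includeLeft : L →ₐ[k] L ⊗[k] K).comp g)) (toConv includeRight)
    rw [← toConv_translate] at h1
    have h2 : (productMap includeLeft (translate g')).comp
        ((includeLeft : L →ₐ[k] L ⊗[k] K).comp g) = includeLeft.comp g := by
      ext x; simp
    have h3 : (productMap includeLeft (translate g')).comp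
        (includeRight : K →ₐ[k] L ⊗[k] K) = translate g' := by
      ext x; simp
    have h4 : toConv ((includeLeft : L →ₐ[k] L ⊗[k] K).comp g) *
        toConv (includeLeft.comp g') = 1 := by
      have h5 := AlgHom.comp_convMul_distrib (includeLeft : L →ₐ[k] L ⊗[k] K)
        (toConv g) (toConv g')
      rw [h] at h5
      rw [WithConv.ext_iff]
      refine Eq.trans (Eq.trans ?_ h5.symm) ?_
      · rfl
      · ext x
        exact (includeLeft : L →ₐ[k] L ⊗[k] K).commutes _
    have h6 : toConv ((includeLeft : L →ₐ[k] L ⊗[k] K).comp g) * toConv (translate g') =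
        toConv includeRight := by
      rw [toConv_translate, ← mul_assoc, h4, one_mul]
    simp only at h1
    rw [h2, h3, h6] at h1
    ext x
    simpa [← Algebra.TensorProduct.one_def] using DFunLike.congr_fun h1 x

theorem HopfAlgebra.bijective_productMap_translate (g : K →ₐ[k] L) :
    Function.Bijective (productMap (includeLeft : L →ₐ[k] L ⊗[k] K) (translate g)) := by
  refine Function.bijective_iff_has_inverse.2
    ⟨productMap includeLeft (translate (g.comp (antipodeAlgHom k K))), fun x => ?_, fun x => ?_⟩
  · exact DFunLike.congr_fun
      (productMap_translate_comp (AlgHom.toConv_mul_comp_antipode g)) x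
  · exact DFunLike.congr_fun
      (productMap_translate_comp (AlgHom.toConv_comp_antipode_mul g)) x

/-- Translation by the rational point `g`, as an automorphism of the ring of functions. -/
noncomputable def HopfAlgebra.translateEquiv (g : K →ₐ[k] k) : K ≃ₐ[k] K :=
  AlgEquiv.ofBijective ((Algebra.TensorProduct.lid k K).toAlgHom.comp (translate g)) (by
    have h := bijective_productMap_translate g
    have e : ((Algebra.TensorProduct.lid k K).toAlgHom.comp (translate g) : K → K) =
        (Algebra.TensorProduct.lid k K) ∘ (productMap includeLeft (translate g)) ∘
          (Algebra.TensorProduct.lid k K).symm := by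
      ext x; simp
    rw [e]
    exact (AlgEquiv.bijective _).comp (h.comp (AlgEquiv.bijective _)))

theorem HopfAlgebra.comp_translateEquiv (g p : K →ₐ[k] k) :
    toConv (p.comp (translateEquiv g).toAlgHom) = toConv g * toConv p := by
  ext x
  rw [AlgHom.convMul_apply]
  have : p.comp ((Algebra.TensorProduct.lid k K).toAlgHom.comp (map g (AlgHom.id k K))) =
      Algebra.TensorProduct.lift g p (fun _ _ => Commute.all _ _) := by
    ext <;> simp
  exact DFunLike.congr_fun this _

end Translation

/-! ### Orbit maps, and triviality in the presence of a rational point -/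

namespace ComoduleAlgebra

open Algebra.TensorProduct WithConv

variable {k : Type u} {K : Type v} {B : Type w} {L : Type w'} [Field k] [CommRing K]
  [HopfAlgebra k K] [CommRing B] [Algebra k B] [CommRing L] [Algebra k L]
  (ρ : ComoduleAlgebra k K B)

/-- The map `b ↦ x(b₀) ⊗ b₁` attached to an `L`-valued point `x`. -/
noncomputable def orbitMap (x : B →ₐ[k] L) : B →ₐ[k] L ⊗[k] K :=
  (map x (AlgHom.id k K)).comp ρ.coact

/-- The orbit map `b ↦ z(b₀) b₁` of a rational point `z`. -/
noncomputable def orbit (z : B →ₐ[k] k) : B →ₐ[k] K :=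
  (Algebra.TensorProduct.lid k K).toAlgHom.comp (ρ.orbitMap z)

theorem coassoc_comp : (Algebra.TensorProduct.assoc k k k B K K).toAlgHom.comp
    ((map ρ.coact (AlgHom.id k K)).comp ρ.coact) =
      (map (AlgHom.id k B) (Bialgebra.comulAlgHom k K)).comp ρ.coact :=
  AlgHom.ext ρ.coassoc

/-- Coassociativity, read on points as `x (g h) = (x g) h`. -/
theorem translate_comp_orbitMap (x : B →ₐ[k] L) (g : K →ₐ[k] L) :
    (productMap includeLeft (HopfAlgebra.translate g)).comp (ρ.orbitMap x) =
      ρ.orbitMap ((productMap x g).comp ρ.coact) := by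
  let F : B ⊗[k] (K ⊗[k] K) →ₐ[k] L ⊗[k] K :=
    productMap ((includeLeft : L →ₐ[k] L ⊗[k] K).comp x) (map g (AlgHom.id k K))
  have h1 : F.comp (map (AlgHom.id k B) (Bialgebra.comulAlgHom k K)) =
      (productMap includeLeft (HopfAlgebra.translate g)).comp (map x (AlgHom.id k K)) := by
    ext y <;> simp [F, HopfAlgebra.translate]
  have h2 : (F.comp (Algebra.TensorProduct.assoc k k k B K K).toAlgHom).comp
      (map ρ.coact (AlgHom.id k K)) =
      map ((productMap x g).comp ρ.coact) (AlgHom.id k K) := by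
    have h3 : F.comp (Algebra.TensorProduct.assoc k k k B K K).toAlgHom =
        map (productMap x g) (AlgHom.id k K) := by
      ext y
      · simp [F]
      · simp [F]
      · simp [F, Algebra.TensorProduct.one_def]
    rw [h3]
    ext y <;> simp
  rw [orbitMap, orbitMap, ← AlgHom.comp_assoc, ← h1, AlgHom.comp_assoc, ← ρ.coassoc_comp, ← h2]
  rfl

/-- If `B` becomes isomorphic to `K` over some non-zero algebra `L`, by the orbit map of an
`L`-valued point, then every rational point of `B` gives an isomorphism of `B` with `K`. -/
theorem bijective_orbit [Nontrivial L] (x : B →ₐ[k] L)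
    (hx : Function.Bijective (productMap (includeLeft : L →ₐ[k] L ⊗[k] K) (ρ.orbitMap x)))
    (z : B →ₐ[k] k) : Function.Bijective (ρ.orbit z) := by
  let e := AlgEquiv.ofBijective _ hx
  let zL : L ⊗[k] B →ₐ[k] L := productMap (AlgHom.id k L) ((Algebra.ofId k L).comp z)
  -- The `L`-valued group element with `x g = z`, obtained by inverting the orbit map of `x`.
  let g : K →ₐ[k] L := (zL.comp e.symm.toAlgHom).comp includeRight
  have h1 : productMap (AlgHom.id k L) g = zL.comp e.symm.toAlgHom := by
    apply Algebra.TensorProduct.ext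
    · ext l
      have : e (l ⊗ₜ 1) = l ⊗ₜ 1 := by simp [e]
      have h2 : e.symm (l ⊗ₜ 1) = l ⊗ₜ 1 := by rw [AlgEquiv.symm_apply_eq, this]
      simp [h2, zL]
    · ext y; simp [g]
  have h2 : (productMap x g).comp ρ.coact = (Algebra.ofId k L).comp z := by
    have h3 : productMap x g = (productMap (AlgHom.id k L) g).comp (map x (AlgHom.id k K)) := by
      ext <;> simp
    ext b
    have h4 : e (1 ⊗ₜ b) = ρ.orbitMap x b := by simp [e, ← Algebra.TensorProduct.one_def]
    rw [h3, h1]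
    change zL (e.symm (ρ.orbitMap x b)) = _
    rw [← h4, AlgEquiv.symm_apply_apply]
    simp [zL]
  have h3 : (productMap includeLeft (HopfAlgebra.translate g)).comp
      (productMap (includeLeft : L →ₐ[k] L ⊗[k] K) (ρ.orbitMap x)) =
      map (AlgHom.id k L) (ρ.orbit z) := by
    apply Algebra.TensorProduct.ext
    · ext l; simp
    · have h4 : (map ((Algebra.ofId k L).comp z) (AlgHom.id k K)) =
        (includeRight : K →ₐ[k] L ⊗[k] K).comp ((Algebra.TensorProduct.lid k K).toAlgHom.comp
          (map z (AlgHom.id k K))) := by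
        ext y
        · simp [Algebra.ofId_apply, Algebra.algebraMap_eq_smul_one]
        · simp
      have h5 := ρ.translate_comp_orbitMap x g
      rw [h2, orbitMap, orbitMap, h4] at h5
      ext b
      have := DFunLike.congr_fun h5 b
      simpa [orbit, orbitMap, ← Algebra.TensorProduct.one_def] using this
  have h4 : Function.Bijective (map (AlgHom.id k L) (ρ.orbit z)) := by
    rw [← h3]
    exact (HopfAlgebra.bijective_productMap_translate g).comp hx
  -- A non-zero algebra over a field is faithfully flat, so bijectivity descends from `L` to `k`.
  exact (Module.FaithfullyFlat.lTensor_bijective_iff_bijective k L (ρ.orbit z).toLinearMap).1 h4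

theorem comul_comp_orbit (z : B →ₐ[k] k) :
    (Bialgebra.comulAlgHom k K).comp (ρ.orbit z) =
      (map (ρ.orbit z) (AlgHom.id k K)).comp ρ.coact := by
  let F : B ⊗[k] (K ⊗[k] K) →ₐ[k] K ⊗[k] K :=
    productMap ((Algebra.ofId k (K ⊗[k] K)).comp z) (AlgHom.id k (K ⊗[k] K))
  have h1 : F.comp (map (AlgHom.id k B) (Bialgebra.comulAlgHom k K)) =
      (Bialgebra.comulAlgHom k K).comp
        ((Algebra.TensorProduct.lid k K).toAlgHom.comp (map z (AlgHom.id k K))) := by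
    ext y
    · simp [F, Algebra.ofId_apply, Algebra.algebraMap_eq_smul_one]
    · simp [F, ← Algebra.TensorProduct.one_def]
  have h2 : (F.comp (Algebra.TensorProduct.assoc k k k B K K).toAlgHom).comp
      (map ρ.coact (AlgHom.id k K)) = map (ρ.orbit z) (AlgHom.id k K) := by
    have h3 : F.comp (Algebra.TensorProduct.assoc k k k B K K).toAlgHom =
        map ((Algebra.TensorProduct.lid k K).toAlgHom.comp (map z (AlgHom.id k K)))
          (AlgHom.id k K) := by
      ext y
      · simp [F, Algebra.ofId_apply, Algebra.algebraMap_eq_smul_one]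
      · simp [F]
      · simp [F, Algebra.TensorProduct.one_def]
    rw [h3]
    ext y <;> simp [orbit, orbitMap]
  have h0 : ρ.orbit z = ((Algebra.TensorProduct.lid k K).toAlgHom.comp
      (map z (AlgHom.id k K))).comp ρ.coact := rfl
  rw [← h2, h0, ← AlgHom.comp_assoc, ← h1, AlgHom.comp_assoc, ← ρ.coassoc_comp]
  rfl

/-- A Galois extension with a rational point is trivial. -/
theorem IsGaloisExtension.nonempty_iso_regular {ρ : ComoduleAlgebra k K B}
    (hρ : ρ.IsGaloisExtension) (z : B →ₐ[k] k) : Nonempty (ρ.Iso (regular k K)) := by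
  have := hρ.nontrivial
  -- For the tautological `B`-valued point, the hypothesis of `bijective_orbit` is the Galois
  -- condition itself.
  have h : ρ.orbitMap (AlgHom.id k B) = ρ.coact := by
    rw [orbitMap, Algebra.TensorProduct.map_id]; rfl
  refine ⟨AlgEquiv.ofBijective (ρ.orbit z) (ρ.bijective_orbit (AlgHom.id k B) ?_ z), fun a => ?_⟩
  · rw [h]; exact hρ.bijective
  · exact DFunLike.congr_fun (ρ.comul_comp_orbit z) a

end ComoduleAlgebra

/-! ### The part of a Galois extension with coefficients in a Hopf subalgebra -/

namespace ComoduleAlgebra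

open Algebra.TensorProduct

variable {k : Type u} {H : Type v} {A : Type w} [Field k] [CommRing H] [HopfAlgebra k H]
  [CommRing A] [Algebra k A] (ρ : ComoduleAlgebra k H A)

/-- The subalgebra of the elements of `A` whose coaction has its coefficients in `K`. -/
noncomputable def coeffIn (K : Subalgebra k H) : Subalgebra k A :=
  ((⊤ : Subalgebra k A).tensor K).comap ρ.coact

theorem mem_coeffIn {K : Subalgebra k H} {a : A} :
    a ∈ ρ.coeffIn K ↔ ρ.coact a ∈ (⊤ : Subalgebra k A).tensor K := Iff.rfl

theorem coeffIn_mono {K L : Subalgebra k H} (h : K ≤ L) : ρ.coeffIn K ≤ ρ.coeffIn L :=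
  fun _ ha => Subalgebra.tensor_mono le_rfl h ha

/-- The coaction modulo `A ⊗ K`. -/
noncomputable def coactMod (K : Subalgebra k H) : A →ₗ[k] A ⊗[k] (H ⧸ Subalgebra.toSubmodule K) :=
  (Subalgebra.toSubmodule K).mkQ.lTensor A ∘ₗ ρ.coact.toLinearMap

/-- Presenting the subalgebra as a kernel makes it commute with tensor products. -/
theorem ker_coactMod (K : Subalgebra k H) :
    LinearMap.ker (ρ.coactMod K) = Subalgebra.toSubmodule (ρ.coeffIn K) := by
  ext a
  rw [LinearMap.mem_ker, Subalgebra.mem_toSubmodule, mem_coeffIn, Subalgebra.mem_top_tensor_iff,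
    TensorProduct.mem_range_lTensor_subtype_iff]
  rfl

/-- The comultiplication modulo `H ⊗ K`. -/
noncomputable def comulMod (K : Subalgebra k H) :
    H →ₗ[k] H ⊗[k] (H ⧸ Subalgebra.toSubmodule K) :=
  (regular k H).coactMod K

/-- If `Δ h ∈ H ⊗ K`, applying the counit to the first factor gives `h ∈ K`. -/
theorem coeffIn_regular (K : Subalgebra k H) [IsHopfSubalgebra K] :
    (regular k H).coeffIn K = K := by
  ext h
  rw [mem_coeffIn]
  constructor
  · intro hh
    have h1 : Algebra.TensorProduct.lid k H (map (Bialgebra.counitAlgHom k H) (AlgHom.id k H)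
        (Bialgebra.comulAlgHom k H h)) = h := by
      have : map (Bialgebra.counitAlgHom k H) (AlgHom.id k H) (Bialgebra.comulAlgHom k H h) =
        (1 : k) ⊗ₜ[k] h := Coalgebra.rTensor_counit_comul h
      rw [this]
      simp
    rw [← h1]
    change Bialgebra.comulAlgHom k H h ∈ _ at hh
    refine Subalgebra.tensor_induction (p := fun x => Algebra.TensorProduct.lid k H
      (map (Bialgebra.counitAlgHom k H) (AlgHom.id k H) x) ∈ K) ?_ ?_ ?_ hh
    · simp
    · intro a _ b hb
      simpa using K.smul_mem hb _
    · intro x y hx hy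
      rw [map_add, map_add]
      exact add_mem hx hy
  · intro hh
    exact Subalgebra.tensor_mono le_top le_rfl (IsHopfSubalgebra.comul_mem h hh)

theorem ker_comulMod (K : Subalgebra k H) [IsHopfSubalgebra K] :
    LinearMap.ker (comulMod K) = Subalgebra.toSubmodule K := by
  rw [comulMod, ker_coactMod, coeffIn_regular]

/-- The coaction maps the subalgebra of elements with coefficients in `K` to its tensor product
with `K`. -/
theorem coact_mem (K : Subalgebra k H) [IsHopfSubalgebra K] {a : A} (ha : a ∈ ρ.coeffIn K) :
    ρ.coact a ∈ (ρ.coeffIn K).tensor K := by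
  rw [Subalgebra.mem_tensor_iff]
  rw [mem_coeffIn] at ha
  refine ⟨?_, Subalgebra.mem_top_tensor_iff.1 ha⟩
  rw [← ker_coactMod, TensorProduct.mem_range_rTensor_ker_iff]
  -- By coassociativity the middle factor comes from `Δ(K) ⊆ K ⊗ K`, so it dies modulo `K`.
  have h1 : (ρ.coactMod K).rTensor H (ρ.coact a) =
      ((Subalgebra.toSubmodule K).mkQ.lTensor A).rTensor H
        ((TensorProduct.assoc k A H H).symm
          (map (AlgHom.id k A) (Bialgebra.comulAlgHom k H) (ρ.coact a))) := by
    rw [← ρ.coassoc a, coactMod, LinearMap.rTensor_comp, LinearMap.comp_apply]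
    congr 1
    exact ((TensorProduct.assoc k A H H).symm_apply_apply _).symm
  rw [h1]
  refine Subalgebra.tensor_induction (p := fun x =>
    ((Subalgebra.toSubmodule K).mkQ.lTensor A).rTensor H
      ((TensorProduct.assoc k A H H).symm
        (map (AlgHom.id k A) (Bialgebra.comulAlgHom k H) x)) = 0) ?_ ?_ ?_ ha
  · simp
  · intro b _ h hh
    simp only [map_tmul, AlgHom.coe_id, id_eq]
    refine Subalgebra.tensor_induction (p := fun x =>
      ((Subalgebra.toSubmodule K).mkQ.lTensor A).rTensor H
        ((TensorProduct.assoc k A H H).symm (b ⊗ₜ x)) = 0) ?_ ?_ ?_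
      (IsHopfSubalgebra.comul_mem h hh)
    · simp
    · intro c hc d _
      have : Submodule.Quotient.mk (p := Subalgebra.toSubmodule K) c = 0 :=
        (Submodule.Quotient.mk_eq_zero _).2 hc
      simp [this]
    · intro x y hx hy
      rw [TensorProduct.tmul_add, map_add, map_add, hx, hy, add_zero]
  · intro x y hx hy
    rw [map_add, map_add, map_add, hx, hy, add_zero]

/-- The restricted coaction, as an algebra map. -/
noncomputable def coactRestrict (K : Subalgebra k H) [IsHopfSubalgebra K] :
    ρ.coeffIn K →ₐ[k] ρ.coeffIn K ⊗[k] K :=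
  Subalgebra.codRestrictTensor (ρ.coeffIn K) K (ρ.coact.comp (ρ.coeffIn K).val)
    fun a => ρ.coact_mem K a.2

theorem map_coactRestrict (K : Subalgebra k H) [IsHopfSubalgebra K] (a : ρ.coeffIn K) :
    map (ρ.coeffIn K).val K.val (ρ.coactRestrict K a) = ρ.coact a :=
  DFunLike.congr_fun (Subalgebra.map_val_codRestrictTensor (ρ.coeffIn K) K
    (ρ.coact.comp (ρ.coeffIn K).val) fun a => ρ.coact_mem K a.2) a

/-- The elements with coefficients in the Hopf subalgebra `K` form a `K`-comodule algebra. -/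
noncomputable def restrict (K : Subalgebra k H) [IsHopfSubalgebra K] :
    ComoduleAlgebra k K (ρ.coeffIn K) where
  coact := ρ.coactRestrict K
  coassoc a := by
    have hinj : Function.Injective (map (ρ.coeffIn K).val (map K.val K.val)) :=
      TensorProduct.map_injective_of_flat_flat (ρ.coeffIn K).val.toLinearMap
        (map K.val K.val).toLinearMap Subtype.val_injective
        (Subalgebra.map_val_injective K K)
    apply hinj
    have e1 : (map (ρ.coeffIn K).val (map K.val K.val)).comp
        ((Algebra.TensorProduct.assoc k k k (ρ.coeffIn K) K K).toAlgHom.comp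
          (map (ρ.coactRestrict K) (AlgHom.id k K))) =
        ((Algebra.TensorProduct.assoc k k k A H H).toAlgHom.comp
          (map ρ.coact (AlgHom.id k H))).comp (map (ρ.coeffIn K).val K.val) := by
      have e3 : (map (ρ.coeffIn K).val (map K.val K.val)).comp
          (Algebra.TensorProduct.assoc k k k (ρ.coeffIn K) K K).toAlgHom =
          (Algebra.TensorProduct.assoc k k k A H H).toAlgHom.comp
            (map (map (ρ.coeffIn K).val K.val) K.val) := by
        ext <;> rfl
      rw [← AlgHom.comp_assoc, e3]
      ext x
      · simp [map_coactRestrict]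
      · simp
    have e2 : (map (ρ.coeffIn K).val (map K.val K.val)).comp
          (map (AlgHom.id k (ρ.coeffIn K)) (Bialgebra.comulAlgHom k K)) =
        (map (AlgHom.id k A) (Bialgebra.comulAlgHom k H)).comp (map (ρ.coeffIn K).val K.val) := by
      apply Algebra.TensorProduct.ext
      · ext x; simp
      · ext x
        have := IsHopfSubalgebra.map_val_comul K x
        simp only [Bialgebra.comulAlgHom_apply] at this
        simp [this]
    have h1 := DFunLike.congr_fun e1 (ρ.coactRestrict K a)
    have h2 := DFunLike.congr_fun e2 (ρ.coactRestrict K a)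
    refine (h1.trans ?_).trans h2.symm
    rw [AlgHom.comp_apply, AlgHom.comp_apply, AlgHom.comp_apply, map_coactRestrict]
    exact ρ.coassoc a
  counit a := by
    apply Subtype.val_injective
    have e : (ρ.coeffIn K).val.comp ((Algebra.TensorProduct.rid k k (ρ.coeffIn K)).toAlgHom.comp
        (map (AlgHom.id k (ρ.coeffIn K)) (Bialgebra.counitAlgHom k K))) =
        ((Algebra.TensorProduct.rid k k A).toAlgHom.comp
          (map (AlgHom.id k A) (Bialgebra.counitAlgHom k H))).comp
            (map (ρ.coeffIn K).val K.val) := by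
      apply Algebra.TensorProduct.ext
      · ext x; simp
      · ext x
        simp
        rfl
    refine (DFunLike.congr_fun e (ρ.coactRestrict K a)).trans ?_
    rw [AlgHom.comp_apply, map_coactRestrict]
    exact ρ.counit a

variable {ρ}

theorem galoisMap_tmul (a b : A) : ρ.galoisMap (a ⊗ₜ b) = (a ⊗ₜ 1) * ρ.coact b := by
  simp [galoisMap]

/-- The Galois map is colinear. -/
theorem rTensor_galoisMap_coactMod (K : Subalgebra k H) (x : A ⊗[k] A) :
    ρ.galoisMap.toLinearMap.rTensor _
        ((TensorProduct.assoc k A A _).symm ((ρ.coactMod K).lTensor A x)) =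
      (TensorProduct.assoc k A H _).symm ((comulMod K).lTensor A (ρ.galoisMap x)) := by
  induction x with
  | zero => simp
  | add x y hx hy => simp only [map_add, hx, hy]
  | tmul a b =>
    have e1 : ∀ y : A ⊗[k] H, ρ.galoisMap.toLinearMap.rTensor _ ((TensorProduct.assoc k A A _).symm
        (a ⊗ₜ (Subalgebra.toSubmodule K).mkQ.lTensor A y)) =
        (LinearMap.mulLeft k (a ⊗ₜ (1 : H))).rTensor _
          ((TensorProduct.assoc k A H _).symm
            (((Subalgebra.toSubmodule K).mkQ.lTensor H).lTensor A
              (TensorProduct.assoc k A H H (ρ.coact.toLinearMap.rTensor H y)))) := by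
      intro y
      induction y with
      | zero => simp
      | add x y hx hy => simp only [map_add, TensorProduct.tmul_add, hx, hy]
      | tmul b h =>
        simp only [LinearMap.lTensor_tmul, TensorProduct.assoc_symm_tmul, LinearMap.rTensor_tmul,
          AlgHom.toLinearMap_apply, galoisMap_tmul]
        generalize ρ.coact b = z
        induction z with
        | zero => simp
        | add x y hx hy => simp only [map_add, mul_add, TensorProduct.add_tmul, hx, hy]
        | tmul c d => simp
    have e2 : ∀ y : A ⊗[k] H, (TensorProduct.assoc k A H _).symm
        ((comulMod K).lTensor A ((a ⊗ₜ 1) * y)) =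
        (LinearMap.mulLeft k (a ⊗ₜ (1 : H))).rTensor _
          ((TensorProduct.assoc k A H _).symm
            (((Subalgebra.toSubmodule K).mkQ.lTensor H).lTensor A
              (map (AlgHom.id k A) (Bialgebra.comulAlgHom k H) y))) := by
      intro y
      induction y with
      | zero => simp
      | add x y hx hy => simp only [map_add, mul_add, hx, hy]
      | tmul b h =>
        have : comulMod K h = (Subalgebra.toSubmodule K).mkQ.lTensor H
          (Bialgebra.comulAlgHom k H h) := rfl
        simp only [tmul_mul_tmul, one_mul, LinearMap.lTensor_tmul, this, map_tmul, AlgHom.coe_id,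
          id_eq]
        generalize (Bialgebra.comulAlgHom k H h) = z
        induction z with
        | zero => simp
        | add x y hx hy => simp only [map_add, TensorProduct.tmul_add, hx, hy]
        | tmul c d => simp
    rw [LinearMap.lTensor_tmul, galoisMap_tmul, e2, ← ρ.coassoc b]
    exact e1 (ρ.coact b)

/-- Both memberships are vanishing conditions after a coaction modulo `K`; the Galois map is
injective and intertwines the two coactions. -/
theorem galoisMap_mem_iff (hρ : ρ.IsGaloisExtension) (K : Subalgebra k H) [IsHopfSubalgebra K]
    (x : A ⊗[k] A) :
    ρ.galoisMap x ∈ (⊤ : Subalgebra k A).tensor K ↔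
      x ∈ (⊤ : Subalgebra k A).tensor (ρ.coeffIn K) := by
  have hinj : Function.Injective (ρ.galoisMap.toLinearMap.rTensor
      (H ⧸ Subalgebra.toSubmodule K)) :=
    Module.Flat.rTensor_preserves_injective_linearMap _ hρ.bijective.1
  have h1 : ∀ y : A ⊗[k] H, y ∈ LinearMap.range ((Subalgebra.toSubmodule K).subtype.lTensor A) ↔
      (comulMod K).lTensor A y = 0 := fun y => by
    rw [← TensorProduct.mem_range_lTensor_ker_iff, ker_comulMod]
  rw [Subalgebra.mem_top_tensor_iff, Subalgebra.mem_top_tensor_iff, ← ker_coactMod, h1,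
    TensorProduct.mem_range_lTensor_ker_iff,
    ← (TensorProduct.assoc k A H _).symm.map_eq_zero_iff, ← rTensor_galoisMap_coactMod,
    map_eq_zero_iff _ hinj, LinearEquiv.map_eq_zero_iff]

/-- The subalgebra of elements with coefficients in `K` becomes isomorphic to `K` over `A`. -/
theorem bijective_orbitMap_restrict (hρ : ρ.IsGaloisExtension) (K : Subalgebra k H)
    [IsHopfSubalgebra K] :
    Function.Bijective (productMap (includeLeft : A →ₐ[k] A ⊗[k] K)
      ((ρ.restrict K).orbitMap (ρ.coeffIn K).val)) := by
  have hK : Function.Injective (map (AlgHom.id k A) K.val) :=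
    Module.Flat.lTensor_preserves_injective_linearMap K.val.toLinearMap Subtype.val_injective
  have hA : Function.Injective (map (AlgHom.id k A) (ρ.coeffIn K).val) :=
    Module.Flat.lTensor_preserves_injective_linearMap (ρ.coeffIn K).val.toLinearMap
      Subtype.val_injective
  have hcomm : (map (AlgHom.id k A) K.val).comp (productMap (includeLeft : A →ₐ[k] A ⊗[k] K)
      ((ρ.restrict K).orbitMap (ρ.coeffIn K).val)) =
      ρ.galoisMap.comp (map (AlgHom.id k A) (ρ.coeffIn K).val) := by
    apply Algebra.TensorProduct.ext
    · ext a; simp [galoisMap]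
    · ext b
      have h1 : (map (AlgHom.id k A) K.val).comp (map (ρ.coeffIn K).val (AlgHom.id k K)) =
          map (ρ.coeffIn K).val K.val := by
        ext <;> simp
      have h2 := DFunLike.congr_fun h1 (ρ.coactRestrict K b)
      rw [map_coactRestrict] at h2
      simpa [galoisMap, orbitMap, restrict, ← Algebra.TensorProduct.one_def] using h2
  constructor
  · refine Function.Injective.of_comp (f := map (AlgHom.id k A) K.val) ?_
    rw [← AlgHom.coe_comp, hcomm]
    exact hρ.bijective.1.comp hA
  · intro y
    obtain ⟨x, hx⟩ := hρ.bijective.2 (map (AlgHom.id k A) K.val y)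
    have h1 : ρ.galoisMap x ∈ (⊤ : Subalgebra k A).tensor K := by
      rw [hx, Subalgebra.mem_top_tensor_iff]
      exact ⟨y, rfl⟩
    rw [galoisMap_mem_iff hρ, Subalgebra.mem_top_tensor_iff] at h1
    obtain ⟨z, rfl⟩ := h1
    refine ⟨z, hK ?_⟩
    rw [← hx]
    exact DFunLike.congr_fun hcomm z

theorem bijective_orbit_restrict (hρ : ρ.IsGaloisExtension) (K : Subalgebra k H)
    [IsHopfSubalgebra K] (z : ρ.coeffIn K →ₐ[k] k) :
    Function.Bijective ((ρ.restrict K).orbit z) :=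
  have := hρ.nontrivial
  (ρ.restrict K).bijective_orbit _ (bijective_orbitMap_restrict hρ K) z

/-- Finite type descends from `A ⊗ A_K ≅ A ⊗ K` along the faithfully flat map `k → A`. -/
theorem finiteType_coeffIn (hρ : ρ.IsGaloisExtension) (K : Subalgebra k H)
    [IsHopfSubalgebra K] (hK : K.FG) : Algebra.FiniteType k (ρ.coeffIn K) := by
  have := hρ.nontrivial
  have : Algebra.FiniteType k K := K.fg_iff_finiteType.1 hK
  have : Algebra.FiniteType A (A ⊗[k] K) := inferInstance
  let e : A ⊗[k] (ρ.coeffIn K) →ₐ[A] A ⊗[k] K :=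
    Algebra.TensorProduct.lift (Algebra.ofId A _) ((ρ.restrict K).orbitMap (ρ.coeffIn K).val)
      (fun _ _ => Commute.all _ _)
  have he : Function.Bijective e := bijective_orbitMap_restrict hρ K
  have : Algebra.FiniteType A (A ⊗[k] (ρ.coeffIn K)) :=
    Algebra.FiniteType.equiv this (AlgEquiv.ofBijective e he).symm
  exact Algebra.FiniteType.of_finiteType_tensorProduct_of_faithfullyFlat A

/-- Let `V` be the right-hand side. The Galois image `W` of `A ⊗ V` is a subalgebra containing `A`,
`K` and `L`, hence `A ⊗ (K ⊔ L)`. So `ρ(b) ∈ W` for `b` on the left, whence `1 ⊗ b ∈ A ⊗ V` and `b ∈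
V`. -/
theorem coeffIn_sup (hρ : ρ.IsGaloisExtension) (K L : Subalgebra k H)
    [IsHopfSubalgebra K] [IsHopfSubalgebra L] :
    ρ.coeffIn (K ⊔ L) = ρ.coeffIn K ⊔ ρ.coeffIn L := by
  have := hρ.nontrivial
  refine le_antisymm ?_ (sup_le (ρ.coeffIn_mono le_sup_left) (ρ.coeffIn_mono le_sup_right))
  set V := ρ.coeffIn K ⊔ ρ.coeffIn L with hV
  let W : Subalgebra k (A ⊗[k] H) := ((⊤ : Subalgebra k A).tensor V).map ρ.galoisMap
  have hW : ∀ M : Subalgebra k H, IsHopfSubalgebra M → ρ.coeffIn M ≤ V →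
      M ≤ W.comap includeRight := by
    intro M _ hM h hh
    obtain ⟨x, hx⟩ := hρ.bijective.2 (1 ⊗ₜ h)
    refine ⟨x, Subalgebra.tensor_mono le_rfl hM ?_, hx⟩
    rw [← galoisMap_mem_iff hρ, hx]
    exact Subalgebra.tmul_mem_tensor trivial hh
  have hKL : K ⊔ L ≤ W.comap includeRight :=
    sup_le (hW K ‹_› le_sup_left) (hW L ‹_› le_sup_right)
  intro b hb
  have h1 : ρ.galoisMap (1 ⊗ₜ b) ∈ W := by
    rw [galoisMap_tmul, ← Algebra.TensorProduct.one_def, one_mul]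
    refine Subalgebra.tensor_induction (p := fun x => x ∈ W) (zero_mem _) ?_
      (fun _ _ => add_mem) hb
    intro a _ h hh
    have h2 : a ⊗ₜ[k] h = a ⊗ₜ 1 * 1 ⊗ₜ h := by simp
    rw [h2]
    refine mul_mem ⟨a ⊗ₜ 1, Subalgebra.tmul_mem_tensor trivial (one_mem _), ?_⟩ (hKL hh)
    simp [galoisMap]
  obtain ⟨x, hx, hx'⟩ := h1
  obtain rfl := hρ.bijective.1 hx'
  have h3 := Subalgebra.mem_top_tensor_iff.1 hx
  rw [TensorProduct.mem_range_lTensor_subtype_iff, LinearMap.lTensor_tmul] at h3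
  have h4 : (Subalgebra.toSubmodule V).mkQ b = 0 := by
    by_contra hne
    have hinj := Module.FaithfullyFlat.tensorProduct_mk_injective (A := k) (B := A)
      (A ⧸ Subalgebra.toSubmodule V)
    exact hne (hinj (h3.trans (TensorProduct.tmul_zero _ _).symm))
  rwa [Submodule.mkQ_apply, Submodule.Quotient.mk_eq_zero] at h4

end ComoduleAlgebra

/-! ### Constructible images and surjectivity on rational points -/

section Constructible

/-- The frontier of a constructible set is nowhere dense. -/
theorem Topology.IsConstructible.interior_frontier {X : Type*} [TopologicalSpace X] {s : Set X}
    (hs : Topology.IsConstructible s) : interior (frontier s) = ∅ := by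
  induction hs using BooleanSubalgebra.closure_bot_sup_induction with
  | mem s hs => rw [← frontier_compl, _root_.interior_frontier hs.1.isClosed_compl]
  | bot => simp
  | sup s _ t _ hs ht =>
    refine Set.subset_eq_empty (interior_mono ((frontier_union_subset s t).trans
      (Set.union_subset_union Set.inter_subset_left Set.inter_subset_right))) ?_
    rw [interior_union_isClosed_of_interior_empty isClosed_frontier ht, hs]
  | compl s _ hs => rwa [frontier_compl]

/-- A dense constructible set contains a dense open set. -/
theorem Topology.IsConstructible.dense_interior {X : Type*} [TopologicalSpace X] {s : Set X}
    (hs : Topology.IsConstructible s) (hd : Dense s) : Dense (interior s) := by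
  have h := interior_eq_empty_iff_dense_compl.1 hs.interior_frontier
  rwa [frontier, hd.closure_eq, ← Set.compl_eq_univ_sdiff, compl_compl] at h

end Constructible

section Nullstellensatz

variable {k : Type u} [Field k] [IsAlgClosed k]

/-- By the Nullstellensatz the residue field is finite over `k`, hence equal to it. -/
theorem Ideal.IsMaximal.exists_algHom_ker_eq {R : Type v} [CommRing R] [Algebra k R]
    [Algebra.FiniteType k R] (m : Ideal R) [m.IsMaximal] :
    ∃ p : R →ₐ[k] k, RingHom.ker p = m := by
  let := Ideal.Quotient.field m
  have : Module.Finite k (R ⧸ m) := finite_of_finite_type_of_isJacobsonRing k (R ⧸ m)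
  have h : Function.Bijective (algebraMap k (R ⧸ m)) :=
    IsAlgClosed.algebraMap_bijective_of_isIntegral
  let e : k ≃ₐ[k] (R ⧸ m) := AlgEquiv.ofBijective (Algebra.ofId k (R ⧸ m)) h
  refine ⟨e.symm.toAlgHom.comp (Ideal.Quotient.mkₐ k m), ?_⟩
  ext x
  simp [RingHom.mem_ker, Ideal.Quotient.eq_zero_iff_mem]

theorem Algebra.FiniteType.nonempty_algHom (R : Type v) [CommRing R] [Nontrivial R] [Algebra k R]
    [Algebra.FiniteType k R] : Nonempty (R →ₐ[k] k) := by
  obtain ⟨m, hm⟩ := Ideal.exists_maximal R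
  exact ⟨(hm.exists_algHom_ker_eq (k := k)).choose⟩

theorem AlgHom.eq_of_ker_le {k : Type u} [Field k] {R : Type v} [CommRing R] [Algebra k R] {p q : R →ₐ[k] k}
    (h : RingHom.ker p ≤ RingHom.ker q) : p = q := by
  ext x
  have h1 : x - algebraMap k R (p x) ∈ RingHom.ker p := by simp [RingHom.mem_ker]
  have h2 := h h1
  rw [RingHom.mem_ker, map_sub, AlgHom.commutes, sub_eq_zero] at h2
  exact h2.symm

/-- The prime `P` need not be closed. A point `q` on a maximal ideal above `P` still works: the
kernel of its restriction contains that of `p`, which determines the point. -/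
theorem AlgHom.exists_comp_eq_of_ker_mem_range {R : Type v} {S : Type w} [CommRing R] [CommRing S]
    [Algebra k R] [Algebra k S] [Algebra.FiniteType k S] (i : R →ₐ[k] S) (p : R →ₐ[k] k)
    {P : PrimeSpectrum S} (hP : RingHom.ker p = (PrimeSpectrum.comap i.toRingHom P).asIdeal) :
    ∃ q : S →ₐ[k] k, q.comp i = p := by
  obtain ⟨n, hn, hPn⟩ := P.asIdeal.exists_le_maximal P.isPrime.ne_top
  obtain ⟨q, rfl⟩ := hn.exists_algHom_ker_eq (k := k)
  refine ⟨q, (AlgHom.eq_of_ker_le fun x hx => ?_).symm⟩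
  rw [hP] at hx
  exact hPn hx

end Nullstellensatz

section PointsOfHopfAlgebras

variable {k : Type u} [Field k] [IsAlgClosed k] {K : Type v} {L : Type w} [CommRing K]
  [HopfAlgebra k K] [CommRing L] [HopfAlgebra k L]

open WithConv

/-- A dominant homomorphism of algebraic groups is surjective on rational points. -/
theorem HopfAlgebra.exists_comp_eq_of_injective [Algebra.FiniteType k K] [Algebra.FiniteType k L]
    (i : K →ₐc[k] L) (hi : Function.Injective i) (g : K →ₐ[k] k) :
    ∃ g' : L →ₐ[k] k, g'.comp (i : K →ₐ[k] L) = g := by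
  have : IsNoetherianRing K := Algebra.FiniteType.isNoetherianRing k K
  have : IsJacobsonRing K := isJacobsonRing_of_finiteType (A := k)
  have : Nontrivial K := (Bialgebra.counitAlgHom k K).toRingHom.domain_nontrivial
  let f : K →+* L := (i : K →ₐ[k] L).toRingHom
  have hf : f.FiniteType :=
    RingHom.FiniteType.of_comp_finiteType (f := algebraMap k K) (by
      rw [show f.comp (algebraMap k K) = algebraMap k L from (i : K →ₐ[k] L).comp_algebraMap]
      exact RingHom.finiteType_algebraMap.2 ‹_›)
  have hc := PrimeSpectrum.isConstructible_range_comap (RingHom.FinitePresentation.of_finiteType.1 hf)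
  have hd : DenseRange (PrimeSpectrum.comap f) := by
    rw [PrimeSpectrum.denseRange_comap_iff_ker_le_nilRadical,
      (RingHom.injective_iff_ker_eq_bot f).1 hi]
    exact bot_le
  set V := interior (Set.range (PrimeSpectrum.comap f))
  have hV : Dense V := hc.dense_interior hd
  -- The image contains a dense open `V` by Chevalley. `V` and its translate meet in a closed point
  -- `p`, so both `p` and `g p` lift.
  let σ := translateEquiv g
  let τ := PrimeSpectrum.homeomorphOfRingEquiv σ.symm.toRingEquiv
  have hV' : Dense (τ ⁻¹' V) := hV.preimage τ.isOpenMap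
  obtain ⟨x, ⟨hxV, hxV'⟩, hx⟩ := nonempty_inter_closedPoints
    (hV.inter_of_isOpen_left hV' isOpen_interior).nonempty
    (isOpen_interior.inter (isOpen_interior.preimage τ.continuous)).isLocallyClosed
  rw [mem_closedPoints_iff, PrimeSpectrum.isClosed_singleton_iff_isMaximal] at hx
  obtain ⟨p, hp⟩ := hx.exists_algHom_ker_eq (k := k)
  obtain ⟨y, hy⟩ := interior_subset hxV
  obtain ⟨y', hy'⟩ := interior_subset hxV'
  obtain ⟨p', hp'⟩ := AlgHom.exists_comp_eq_of_ker_mem_range (i : K →ₐ[k] L) p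
    (P := y) (by rw [hp]; exact congrArg PrimeSpectrum.asIdeal hy.symm)
  obtain ⟨q', hq'⟩ := AlgHom.exists_comp_eq_of_ker_mem_range (i : K →ₐ[k] L)
    (p.comp σ.toAlgHom) (P := y') (by
      refine Eq.trans ?_ (congrArg PrimeSpectrum.asIdeal hy'.symm)
      ext z
      change p (σ z) = 0 ↔ σ z ∈ x.asIdeal
      rw [← hp, RingHom.mem_ker])
  -- This lifts `g = (g p) p⁻¹`.
  refine ⟨(toConv q' * toConv (p'.comp (antipodeAlgHom k L))).ofConv, ?_⟩
  have h1 := AlgHom.convMul_comp_bialgHom_distrib (toConv p')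
    (toConv (p'.comp (antipodeAlgHom k L))) i
  rw [AlgHom.toConv_mul_comp_antipode] at h1
  have h2 : toConv p * toConv ((p'.comp (antipodeAlgHom k L)).comp (i : K →ₐ[k] L)) = 1 := by
    rw [← hp', WithConv.ext_iff]
    refine h1.symm.trans ?_
    ext z
    exact congrArg (algebraMap k k) (CoalgHomClass.counit_comp_apply i z)
  rw [AlgHom.convMul_comp_bialgHom_distrib]
  simp only
  rw [hq', comp_translateEquiv, mul_assoc, h2, mul_one]

end PointsOfHopfAlgebras

/-! ### Existence of a rational point of a Galois extension -/

theorem Subalgebra.mem_top_tensor {k A B : Type*} [Field k] [CommRing A] [Algebra k A] [CommRing B]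
    [Algebra k B] (x : A ⊗[k] B) : x ∈ (⊤ : Subalgebra k A).tensor (⊤ : Subalgebra k B) :=
  mem_top_tensor_iff.2 <| LinearMap.lTensor_surjective A
    (g := (Subalgebra.toSubmodule (⊤ : Subalgebra k B)).subtype) (fun b => ⟨⟨b, trivial⟩, rfl⟩) x

instance IsHopfSubalgebra.top {k : Type u} {H : Type v} [Field k] [CommRing H] [HopfAlgebra k H] :
    IsHopfSubalgebra (⊤ : Subalgebra k H) :=
  ⟨fun _ _ => Subalgebra.mem_top_tensor _, fun _ _ => trivial⟩

namespace ComoduleAlgebra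

open Algebra.TensorProduct

variable {k : Type u} {H : Type v} {A : Type w} [Field k] [CommRing H] [HopfAlgebra k H]
  [CommRing A] [Algebra k A] {ρ : ComoduleAlgebra k H A}

/-- Compatibility of the orbit maps identifies restriction of points from `A_L` to `A_K` with
restriction from `L` to `K`. -/
theorem orbit_restrict_inclusion {K L : Subalgebra k H} [IsHopfSubalgebra K] [IsHopfSubalgebra L]
    (hKL : K ≤ L) (z : ρ.coeffIn L →ₐ[k] k) (b : ρ.coeffIn K) :
    (ρ.restrict L).orbit z (Subalgebra.inclusion (ρ.coeffIn_mono hKL) b) =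
      Subalgebra.inclusion hKL
        ((ρ.restrict K).orbit (z.comp (Subalgebra.inclusion (ρ.coeffIn_mono hKL))) b) := by
  set j := Subalgebra.inclusion (ρ.coeffIn_mono hKL)
  have h1 : ρ.coactRestrict L (j b) = map j (Subalgebra.inclusion hKL) (ρ.coactRestrict K b) := by
    apply Subalgebra.map_val_injective
    have e : (map (ρ.coeffIn L).val L.val).comp (map j (Subalgebra.inclusion hKL)) =
        map (ρ.coeffIn K).val K.val := by
      ext <;> rfl
    have e' := DFunLike.congr_fun e (ρ.coactRestrict K b)
    rw [map_coactRestrict] at e' ⊢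
    exact e'.symm
  have h2 : ((Algebra.TensorProduct.lid k L).toAlgHom.comp (map z (AlgHom.id k L))).comp
      (map j (Subalgebra.inclusion hKL)) =
      (Subalgebra.inclusion hKL).comp ((Algebra.TensorProduct.lid k K).toAlgHom.comp
        (map (z.comp j) (AlgHom.id k K))) := by
    ext x <;> simp
  have h3 := DFunLike.congr_fun h2 (ρ.coactRestrict K b)
  change Algebra.TensorProduct.lid k L (map z (AlgHom.id k L) (ρ.coactRestrict L (j b))) = _
  rw [h1]
  exact h3

theorem mem_coeffIn_top (a : A) : a ∈ ρ.coeffIn ⊤ :=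
  Subalgebra.mem_top_tensor (ρ.coact a)

theorem exists_mem_coeffIn_of_sSup {S : Set (Subalgebra k H)} (hS : S.Nonempty)
    (hd : DirectedOn (· ≤ ·) S) {a : A} (ha : a ∈ ρ.coeffIn (sSup S)) :
    ∃ K ∈ S, a ∈ ρ.coeffIn K := by
  refine Subalgebra.tensor_induction (p := fun x => ∃ K ∈ S, x ∈ (⊤ : Subalgebra k A).tensor K)
    ?_ ?_ ?_ ha
  · obtain ⟨K, hK⟩ := hS
    exact ⟨K, hK, zero_mem _⟩
  · intro b _ h hh
    have h1 : h ∈ ((sSup S : Subalgebra k H) : Set H) := hh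
    have := hS.to_subtype
    rw [sSup_eq_iSup', Subalgebra.coe_iSup_of_directed hd.directed_val] at h1
    obtain ⟨⟨K, hK⟩, hhK⟩ := Set.mem_iUnion.1 h1
    exact ⟨K, hK, Subalgebra.tmul_mem_tensor trivial hhK⟩
  · rintro x y ⟨K, hK, hx⟩ ⟨L, hL, hy⟩
    obtain ⟨M, hM, hKM, hLM⟩ := hd K hK L hL
    exact ⟨M, hM, add_mem (Subalgebra.tensor_mono le_rfl hKM hx)
      (Subalgebra.tensor_mono le_rfl hLM hy)⟩

theorem exists_fg_mem_coeffIn {K : Subalgebra k H} [IsHopfSubalgebra K] {a : A}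
    (ha : a ∈ ρ.coeffIn K) : ∃ L ≤ K, IsHopfSubalgebra L ∧ L.FG ∧ a ∈ ρ.coeffIn L := by
  refine Subalgebra.tensor_induction (p := fun x => ∃ L ≤ K, IsHopfSubalgebra L ∧ L.FG ∧
    x ∈ (⊤ : Subalgebra k A).tensor L) ?_ ?_ ?_ ha
  · obtain ⟨L, hLK, hL, hfg, -⟩ := IsHopfSubalgebra.exists_fg_mem K (zero_mem K)
    exact ⟨L, hLK, hL, hfg, zero_mem _⟩
  · intro b _ h hh
    obtain ⟨L, hLK, hL, hfg, hhL⟩ := IsHopfSubalgebra.exists_fg_mem K hh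
    exact ⟨L, hLK, hL, hfg, Subalgebra.tmul_mem_tensor trivial hhL⟩
  · rintro x y ⟨L, hLK, hL, hfg, hx⟩ ⟨M, hMK, hM, hfg', hy⟩
    exact ⟨L ⊔ M, sup_le hLK hMK, IsHopfSubalgebra.sup L M, hfg.sup hfg',
      add_mem (Subalgebra.tensor_mono le_rfl le_sup_left hx)
        (Subalgebra.tensor_mono le_rfl le_sup_right hy)⟩

/-- The ideal of `A` generated by the kernel of a rational point of a subalgebra. -/
def idealOfPoint {B : Subalgebra k A} (f : B →ₐ[k] k) : Ideal A :=
  Ideal.span (B.val '' (RingHom.ker f : Ideal B))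

variable [IsAlgClosed k]

/-- Rational points of finitely generated parts of a Galois extension can be lifted. -/
theorem exists_point_extension (hρ : ρ.IsGaloisExtension) {K L : Subalgebra k H}
    [IsHopfSubalgebra K] [IsHopfSubalgebra L] (hK : K.FG) (hL : L.FG) (hKL : K ≤ L)
    (f : ρ.coeffIn K →ₐ[k] k) :
    ∃ f' : ρ.coeffIn L →ₐ[k] k, f'.comp (Subalgebra.inclusion (ρ.coeffIn_mono hKL)) = f := by
  have := hρ.nontrivial
  have := finiteType_coeffIn hρ L hL
  have : Algebra.FiniteType k K := K.fg_iff_finiteType.1 hK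
  have : Algebra.FiniteType k L := L.fg_iff_finiteType.1 hL
  -- A base point `y'` and its restriction `y` reduce the lifting problem to the groups.
  obtain ⟨y'⟩ := Algebra.FiniteType.nonempty_algHom (k := k) (ρ.coeffIn L)
  let y := y'.comp (Subalgebra.inclusion (ρ.coeffIn_mono hKL))
  let e := AlgEquiv.ofBijective _ (bijective_orbit_restrict hρ K y)
  obtain ⟨g', hg'⟩ := HopfAlgebra.exists_comp_eq_of_injective (IsHopfSubalgebra.inclusion hKL)
    (Subalgebra.inclusion_injective hKL) (f.comp e.symm.toAlgHom)
  refine ⟨g'.comp ((ρ.restrict L).orbit y'), ?_⟩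
  ext b
  have h1 : g' ((ρ.restrict L).orbit y' (Subalgebra.inclusion (ρ.coeffIn_mono hKL) b)) =
      f (e.symm (e b)) := by
    rw [orbit_restrict_inclusion hKL]
    exact DFunLike.congr_fun hg' (e b)
  rw [AlgEquiv.symm_apply_apply] at h1
  exact h1

theorem idealOfPoint_ne_top (hρ : ρ.IsGaloisExtension) {K : Subalgebra k H}
    [IsHopfSubalgebra K] (f : ρ.coeffIn K →ₐ[k] k) : idealOfPoint f ≠ ⊤ := by
  -- Each `x` in the ideal vanishes at every point of some `A_L` that agrees with `f` on some
  -- `A_{K₀}`, with `K₀` and `L` finitely generated. For `x = 1` this contradicts the existence of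
  -- such points.
  suffices h : ∀ x ∈ idealOfPoint f, ∃ (K₀ L : Subalgebra k H) (_ : IsHopfSubalgebra K₀)
      (_ : IsHopfSubalgebra L) (hKL : K₀ ≤ L) (hK : K₀ ≤ K) (hx : x ∈ ρ.coeffIn L),
      K₀.FG ∧ L.FG ∧ ∀ f' : ρ.coeffIn L →ₐ[k] k,
        f'.comp (Subalgebra.inclusion (ρ.coeffIn_mono hKL)) =
          f.comp (Subalgebra.inclusion (ρ.coeffIn_mono hK)) → f' ⟨x, hx⟩ = 0 by
    intro htop
    obtain ⟨K₀, L, hK₀, hL, hKL, hK, h1, hfg, hfg', h2⟩ :=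
      h 1 ((Ideal.eq_top_iff_one _).1 htop)
    obtain ⟨f', hf'⟩ := exists_point_extension hρ hfg hfg' hKL
      (f.comp (Subalgebra.inclusion (ρ.coeffIn_mono hK)))
    exact one_ne_zero ((map_one f').symm.trans (h2 f' hf'))
  intro x hx
  induction hx using Submodule.span_induction with
  | mem x hx =>
    obtain ⟨x, hx, rfl⟩ := hx
    obtain ⟨L, hLK, hL, hfg, hxL⟩ := exists_fg_mem_coeffIn x.2
    refine ⟨L, L, hL, hL, le_rfl, hLK, hxL, hfg, hfg, fun f' hf' => ?_⟩
    exact (DFunLike.congr_fun hf' (⟨x, hxL⟩ : ρ.coeffIn L)).trans (RingHom.mem_ker.1 hx)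
  | zero =>
    obtain ⟨L, hLK, hL, hfg, -⟩ := IsHopfSubalgebra.exists_fg_mem K (zero_mem K)
    exact ⟨L, L, hL, hL, le_rfl, hLK, zero_mem _, hfg, hfg, fun f' _ => map_zero f'⟩
  | add x y _ _ hx hy =>
    obtain ⟨K₁, L₁, hK₁, hL₁, hKL₁, hKK₁, hx, hfg₁, hfg₁', h₁⟩ := hx
    obtain ⟨K₂, L₂, hK₂, hL₂, hKL₂, hKK₂, hy, hfg₂, hfg₂', h₂⟩ := hy
    refine ⟨K₁ ⊔ K₂, L₁ ⊔ L₂, .sup _ _, .sup _ _, sup_le_sup hKL₁ hKL₂, sup_le hKK₁ hKK₂,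
      add_mem (ρ.coeffIn_mono le_sup_left hx) (ρ.coeffIn_mono le_sup_right hy),
      hfg₁.sup hfg₂, hfg₁'.sup hfg₂', fun f' hf' => ?_⟩
    have e1 := h₁ (f'.comp (Subalgebra.inclusion (ρ.coeffIn_mono le_sup_left)))
      (by ext b; exact DFunLike.congr_fun hf'
            (Subalgebra.inclusion (ρ.coeffIn_mono le_sup_left) b))
    have e2 := h₂ (f'.comp (Subalgebra.inclusion (ρ.coeffIn_mono le_sup_right)))
      (by ext b; exact DFunLike.congr_fun hf'
            (Subalgebra.inclusion (ρ.coeffIn_mono le_sup_right) b))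
    refine (map_add f' ⟨x, ρ.coeffIn_mono le_sup_left hx⟩
      ⟨y, ρ.coeffIn_mono le_sup_right hy⟩).trans ?_
    exact (congrArg₂ (· + ·) e1 e2).trans (add_zero 0)
  | smul a x _ hx =>
    obtain ⟨K₁, L₁, hK₁, hL₁, hKL₁, hKK₁, hx, hfg₁, hfg₁', h₁⟩ := hx
    obtain ⟨L₂, -, hL₂, hfg₂, ha⟩ := exists_fg_mem_coeffIn (ρ := ρ) (mem_coeffIn_top a)
    refine ⟨K₁, L₁ ⊔ L₂, hK₁, .sup _ _, hKL₁.trans le_sup_left, hKK₁,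
      mul_mem (ρ.coeffIn_mono le_sup_right ha) (ρ.coeffIn_mono le_sup_left hx),
      hfg₁, hfg₁'.sup hfg₂, fun f' hf' => ?_⟩
    have e1 := h₁ (f'.comp (Subalgebra.inclusion (ρ.coeffIn_mono le_sup_left)))
      (by ext b; exact DFunLike.congr_fun hf' b)
    refine (map_mul f' ⟨a, ρ.coeffIn_mono le_sup_right ha⟩
      ⟨x, ρ.coeffIn_mono le_sup_left hx⟩).trans ?_
    exact (congrArg (_ * ·) e1).trans (mul_zero _)

/-- A Galois extension of an algebraically closed field has a rational point. -/
theorem IsGaloisExtension.nonempty_point (hρ : ρ.IsGaloisExtension) : Nonempty (A →ₐ[k] k) := by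
  have := hρ.nontrivial
  -- A pair `(K, I)` encodes a point of `A_K`, with `I` the ideal of its fibre. Ideals of the fixed
  -- ring `A` make extension of points a componentwise order, with suprema of chains.
  let S : Set (Subalgebra k H × Ideal A) := {p | IsHopfSubalgebra p.1 ∧ p.2 ≠ ⊤ ∧
    p.2 ≤ Ideal.span (p.2 ∩ ρ.coeffIn p.1) ∧
    ∀ a ∈ ρ.coeffIn p.1, ∃ c : k, a - algebraMap k A c ∈ p.2}
  have hpoint : ∀ (K : Subalgebra k H) (_ : IsHopfSubalgebra K) (f : ρ.coeffIn K →ₐ[k] k),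
      (K, idealOfPoint f) ∈ S := by
    refine fun K hK f => ⟨hK, idealOfPoint_ne_top hρ f, Ideal.span_mono ?_, fun a ha => ?_⟩
    · rintro _ ⟨x, hx, rfl⟩
      exact ⟨Ideal.subset_span ⟨x, hx, rfl⟩, x.2⟩
    · refine ⟨f ⟨a, ha⟩, Ideal.subset_span
        ⟨⟨a, ha⟩ - algebraMap k _ (f ⟨a, ha⟩), ?_, rfl⟩⟩
      simp [RingHom.mem_ker]
  have hstart : ∃ p, p ∈ S := by
    obtain ⟨L, -, hL, hfg, -⟩ := IsHopfSubalgebra.exists_fg_mem (⊤ : Subalgebra k H)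
      (zero_mem _)
    have := finiteType_coeffIn hρ L hfg
    obtain ⟨y⟩ := Algebra.FiniteType.nonempty_algHom (k := k) (ρ.coeffIn L)
    exact ⟨_, hpoint L hL y⟩
  have hchain : ∀ c ⊆ S, IsChain (· ≤ ·) c → ∀ y ∈ c, ∃ ub ∈ S, ∀ z ∈ c, z ≤ ub := by
    intro c hcS hc y hy
    have hd1 : DirectedOn (· ≤ ·) (Prod.fst '' c) :=
      (hc.image (OrderHom.fst : _ × Ideal A →o _)).directedOn
    have hd2 : DirectedOn (· ≤ ·) (Prod.snd '' c) :=
      (hc.image (OrderHom.snd : Subalgebra k H × _ →o _)).directedOn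
    have hle : ∀ z ∈ c, z ≤ (sSup (Prod.fst '' c), sSup (Prod.snd '' c)) :=
      fun z hz => ⟨le_sSup ⟨z, hz, rfl⟩, le_sSup ⟨z, hz, rfl⟩⟩
    refine ⟨(sSup (Prod.fst '' c), sSup (Prod.snd '' c)), ⟨?_, ?_, ?_, ?_⟩, hle⟩
    · refine IsHopfSubalgebra.sSup _ ?_
      rintro _ ⟨z, hz, rfl⟩
      exact (hcS hz).1
    · rw [Ne, Ideal.eq_top_iff_one]
      intro h1
      obtain ⟨_, ⟨z, hz, rfl⟩, h2⟩ := (Submodule.mem_sSup_of_directed (Set.Nonempty.image _ ⟨y, hy⟩) hd2).1 h1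
      exact (hcS hz).2.1 ((Ideal.eq_top_iff_one _).2 h2)
    · refine sSup_le ?_
      rintro _ ⟨z, hz, rfl⟩
      exact (hcS hz).2.2.1.trans (Ideal.span_mono
        (Set.inter_subset_inter (hle z hz).2 (ρ.coeffIn_mono (hle z hz).1)))
    · intro a ha
      obtain ⟨_, ⟨z, hz, rfl⟩, haz⟩ := exists_mem_coeffIn_of_sSup
        (Set.Nonempty.image _ ⟨y, hy⟩) hd1 ha
      obtain ⟨b, hb⟩ := (hcS hz).2.2.2 a haz
      exact ⟨b, (hle z hz).2 hb⟩
  obtain ⟨p₀, hp₀⟩ := hstart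
  obtain ⟨⟨K, I⟩, -, ⟨hK, hI, hIK, hcK⟩, hmax⟩ := zorn_le_nonempty₀ S hchain p₀ hp₀
  dsimp only at hK hI hIK hcK
  have hle : ∀ F : Subalgebra k H, IsHopfSubalgebra F → F.FG → F ≤ K := by
    intro F hF hfg
    have := finiteType_coeffIn hρ F hfg
    have : Nontrivial (A ⧸ I) := Ideal.Quotient.nontrivial_iff.2 hI
    -- `A_K` maps to scalars in `A / I`, so the image `R` of `A_F` also contains that of `A_{K ⊔
    -- F}`. A point of `R` then extends the given point to `A_{K ⊔ F}`.
    let R : Subalgebra k (A ⧸ I) := ((Ideal.Quotient.mkₐ k I).comp (ρ.coeffIn F).val).range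
    have : Algebra.FiniteType k R :=
      .of_surjective _ (AlgHom.rangeRestrict_surjective _)
    obtain ⟨r⟩ := Algebra.FiniteType.nonempty_algHom (k := k) R
    have hKF : ρ.coeffIn (K ⊔ F) ≤ R.comap (Ideal.Quotient.mkₐ k I) := by
      rw [coeffIn_sup hρ]
      refine sup_le (fun a ha => ?_) fun a ha => ⟨⟨a, ha⟩, rfl⟩
      obtain ⟨b, hb⟩ := hcK a ha
      have : Ideal.Quotient.mkₐ k I a = algebraMap k (A ⧸ I) b :=
        (Ideal.Quotient.mk_eq_mk_iff_sub_mem _ _).2 hb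
      rw [Subalgebra.mem_comap, this]
      exact R.algebraMap_mem b
    let f : ρ.coeffIn (K ⊔ F) →ₐ[k] k := r.comp
      (((Ideal.Quotient.mkₐ k I).comp (ρ.coeffIn (K ⊔ F)).val).codRestrict R fun a => hKF a.2)
    have hf := hpoint (K ⊔ F) (.sup K F) f
    have hIf : I ≤ idealOfPoint f := hIK.trans (Ideal.span_mono (by
      rintro x ⟨hxI, hxK⟩
      refine ⟨⟨x, ρ.coeffIn_mono le_sup_left hxK⟩, ?_, rfl⟩
      change r _ = 0
      convert map_zero r
      exact Subtype.ext <| Ideal.Quotient.eq_zero_iff_mem.2 hxI))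
    exact le_sup_right.trans (hmax hf ⟨le_sup_left, hIf⟩).1
  -- Every element of `A` lies in some `A_L` with `L` finitely generated, hence in `A_K`, so it is a
  -- scalar modulo `I`.
  have hsurj : Function.Surjective (algebraMap k (A ⧸ I)) := by
    intro x
    obtain ⟨a, rfl⟩ := Ideal.Quotient.mk_surjective x
    obtain ⟨L, -, hL, hfg, ha⟩ := exists_fg_mem_coeffIn (ρ := ρ) (mem_coeffIn_top a)
    obtain ⟨b, hb⟩ := hcK a (ρ.coeffIn_mono (hle L hL hfg) ha)
    exact ⟨b, ((Ideal.Quotient.mk_eq_mk_iff_sub_mem _ _).2 hb).symm⟩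
  have : Nontrivial (A ⧸ I) := Ideal.Quotient.nontrivial_iff.2 hI
  exact ⟨(AlgEquiv.ofBijective (Algebra.ofId k (A ⧸ I))
    ⟨(algebraMap k (A ⧸ I)).injective, hsurj⟩).symm.toAlgHom.comp (Ideal.Quotient.mkₐ k I)⟩

end ComoduleAlgebra

/-! ### Torsors with a point -/

namespace RightActionObj

section Shear

variable {C : Type u} [Category.{v} C] [CartesianMonoidalCategory C] {G X : C} [MonObj G]
  (a : RightActionObj G X)

@[simp]
theorem shear_fst : a.shear ≫ fst X X = fst X G := lift_fst _ _

@[simp]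
theorem shear_snd : a.shear ≫ snd X X = a.act := lift_snd _ _

variable [IsIso a.shear]

@[simp]
theorem inv_shear_fst : inv a.shear ≫ fst X G = fst X X := by
  rw [IsIso.inv_comp_eq, shear_fst]

@[simp]
theorem inv_shear_act : inv a.shear ≫ a.act = snd X X := by
  rw [IsIso.inv_comp_eq, shear_snd]

/-- The base change of a torsor to a scheme with a point of it is trivial. -/
@[simps]
noncomputable def trivialization {T : C} (t : T ⟶ X) : T ⊗ G ≅ T ⊗ X where
  hom := lift (fst T G) (t ▷ G ≫ a.act)
  inv := lift (fst T X) (t ▷ X ≫ inv a.shear ≫ snd X G)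
  hom_inv_id := by
    have h : lift (fst T G) (t ▷ G ≫ a.act) ≫ t ▷ X = t ▷ G ≫ a.shear := by
      ext <;> simp
    ext
    · simp
    · simp [reassoc_of% h]
  inv_hom_id := by
    have h : lift (fst T X) (t ▷ X ≫ inv a.shear ≫ snd X G) ≫ t ▷ G = t ▷ X ≫ inv a.shear := by
      ext <;> simp
    ext
    · simp
    · simp [reassoc_of% h]

/-- A torsor with a rational point is trivial. -/
noncomputable def isoRegularOfPoint (x : 𝟙_ C ⟶ X) : a.Iso (regular G) where
  toIso := (λ_ X).symm ≪≫ (a.trivialization x).symm ≪≫ λ_ G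
  equivariant := by
    set φ := (λ_ X).symm ≪≫ (a.trivialization x).symm ≪≫ λ_ G
    -- The inverse is `g ↦ x g`, whose equivariance is associativity of the action.
    have e : φ.inv = lift (toUnit G ≫ x) (𝟙 G) ≫ a.act := by
      have h : lift (toUnit G ≫ x) (𝟙 G) = (λ_ G).inv ≫ x ▷ G := by
        ext <;> simp
      simp [φ, h]
    have h : lift (toUnit G ≫ x) (𝟙 G) ▷ G ≫ (α_ X G G).hom ≫ X ◁ MonObj.mul =
        MonObj.mul ≫ lift (toUnit G ≫ x) (𝟙 G) := by
      have h' : lift (toUnit G ≫ x) (𝟙 G) ▷ G ≫ (α_ X G G).hom ≫ snd X (G ⊗ G) = 𝟙 _ := by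
        ext <;> simp
      ext
      · simp
      · simp [reassoc_of% h']
    have h₁ : φ.inv ▷ G ≫ a.act = MonObj.mul ≫ φ.inv := by
      rw [e, comp_whiskerRight, Category.assoc, a.act_mul, reassoc_of% h]
    rw [← cancel_epi (φ.inv ▷ G), reassoc_of% h₁, inv_hom_whiskerRight_assoc, Iso.inv_hom_id,
      Category.comp_id]
    rfl

end Shear

end RightActionObj

/-! ### Affineness of torsors by descent -/

section Affine

open AlgebraicGeometry Limits

/-- The preimage of a compact open of the base is the image, under the surjective projection, of its
compact preimage in the fibre product. -/
instance AlgebraicGeometry.quasiCompact_descendsAlong :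
    MorphismProperty.DescendsAlong (C := Scheme.{u}) @QuasiCompact (@Surjective ⊓ @Flat ⊓ @QuasiCompact) := by
  refine ⟨fun {A X Y Z fst snd f g} h hf hfst => ⟨fun V hV hVc => ?_⟩⟩
  obtain ⟨⟨hs, -⟩, hq⟩ := hf
  have : Surjective snd := MorphismProperty.of_isPullback h hs
  have h1 := fst.isCompact_preimage (U := f ⁻¹ᵁ ⟨V, hV⟩)
    (f.isCompact_preimage (U := ⟨V, hV⟩) hVc)
  have h2 := h1.image snd.continuous
  convert h2
  change _ = snd '' (((fst ≫ f) ⁻¹ᵁ ⟨V, hV⟩ : A.Opens) : Set _)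
  rw [h.w]
  exact (Set.image_preimage_eq (g ⁻¹' V) snd.surjective).symm

instance AlgebraicGeometry.quasiSeparated_descendsAlong :
    MorphismProperty.DescendsAlong (C := Scheme.{u}) @QuasiSeparated (@Surjective ⊓ @Flat ⊓ @QuasiCompact) := by
  have h1 : MorphismProperty.RespectsIso (C := Scheme.{u}) @QuasiCompact :=
    quasiCompact_isStableUnderBaseChange.respectsIso
  have h2 : MorphismProperty.IsStableUnderBaseChange
      (@Surjective ⊓ @Flat ⊓ @QuasiCompact : MorphismProperty Scheme.{u}) :=
    ⟨fun h hg => ⟨⟨MorphismProperty.of_isPullback h hg.1.1,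
      MorphismProperty.of_isPullback h hg.1.2⟩, MorphismProperty.of_isPullback h hg.2⟩⟩
  rw [quasiSeparated_eq_diagonal_is_quasiCompact]
  exact @MorphismProperty.instDescendsAlongDiagonalOfRespectsIsoOfIsStableUnderBaseChange
    _ _ _ _ _ quasiCompact_descendsAlong h1 h2

/-- Affineness descends along faithfully flat morphisms of affine schemes. -/
theorem AlgebraicGeometry.isAffine_of_isPullback {X Y S T : Scheme.{u}} {f : T ⟶ S} {g : Y ⟶ X}
    {iX : X ⟶ S} {iY : Y ⟶ T} (h : IsPullback g iY iX f) [IsAffine S] [IsAffine T] [IsAffine Y]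
    [Flat f] [Surjective f] : IsAffine X := by
  have hf : (@Surjective ⊓ @Flat ⊓ @QuasiCompact : MorphismProperty Scheme) f :=
    ⟨⟨inferInstance, inferInstance⟩, inferInstance⟩
  have hqc : QuasiCompact iX :=
    MorphismProperty.of_isPullback_of_descendsAlong h.flip hf (inferInstance : QuasiCompact iY)
  have hqs : QuasiSeparated iX :=
    MorphismProperty.of_isPullback_of_descendsAlong h.flip hf (inferInstance : QuasiSeparated iY)
  have : CompactSpace X := (quasiCompact_iff_compactSpace iX).1 hqc
  have : QuasiSeparatedSpace X := (quasiSeparated_iff_quasiSeparatedSpace iX).1 hqs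
  -- Flat base change: the global sections of `Y` are those of `X` base-changed from `S` to `T`.
  have h1 := isIso_pushoutSection_of_isQuasiSeparated_of_flat_right h (US := ⊤) (UT := ⊤)
    (UX := ⊤) (UY := ⊤) le_top le_top (by simp) (isAffineOpen_top S) (isAffineOpen_top T)
    isCompact_univ isQuasiSeparated_univ
  have h2 : IsPushout iX.appTop f.appTop g.appTop iY.appTop := by
    simpa [← Scheme.Hom.appLE_eq_app] using (isIso_pushoutSection_iff ..).1 h1
  have h3 : IsPullback (Spec.map iY.appTop) (Spec.map g.appTop) (Spec.map f.appTop)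
      (Spec.map iX.appTop) := h2.op.map Scheme.Spec
  have h4 : IsPullback g (Y.toSpecΓ ≫ Spec.map iY.appTop) (X.toSpecΓ ≫ Spec.map iX.appTop)
      (Spec.map f.appTop) :=
    .of_iso h (Iso.refl Y) (Iso.refl X) T.isoSpec S.isoSpec (by simp)
      (Scheme.toSpecΓ_naturality iY)
      (Scheme.toSpecΓ_naturality iX)
      (Scheme.toSpecΓ_naturality f)
  -- Thus `X.toSpecΓ` becomes the isomorphism `Y.toSpecΓ` after a faithfully flat base change.
  have h5 : IsPullback Y.toSpecΓ g (Spec.map g.appTop) X.toSpecΓ :=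
    .of_right h4.flip (Scheme.toSpecΓ_naturality g).symm h3
  have hf' := (Flat.flat_and_surjective_iff_faithfullyFlat_of_isAffine f).1 ⟨‹_›, ‹_›⟩
  rw [← flat_and_surjective_SpecMap_iff] at hf'
  have hg : (@Surjective ⊓ @Flat ⊓ @QuasiCompact : MorphismProperty Scheme) (Spec.map g.appTop) :=
    ⟨⟨MorphismProperty.of_isPullback h3 hf'.2, MorphismProperty.of_isPullback h3 hf'.1⟩,
      inferInstance⟩
  have h6 : IsIso X.toSpecΓ := MorphismProperty.of_isPullback_of_descendsAlong
    (P := MorphismProperty.isomorphisms Scheme) h5 hg (inferInstance : IsIso Y.toSpecΓ)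
  exact ⟨h6⟩

/-- A torsor under an affine group scheme over a field is affine. -/
theorem IsTorsor.isAffine {k : Type u} [Field k] {G X : Over (Spec (CommRingCat.of k))}
    [GrpObj G] [IsAffine G.left] {a : RightActionObj G X} (ha : IsTorsor a) : IsAffine X.left := by
  have := ha.isIso_shear
  obtain ⟨x⟩ := ha.nonempty
  obtain ⟨U, hU, hx, -⟩ := exists_isAffineOpen_mem_and_subset (X := X.left) (x := x) (U := ⊤) trivial
  -- The inclusion of a non-empty affine open is a `T`-valued point of `X`, giving `T × X ≅ T × G`.
  let T : Over (Spec (CommRingCat.of k)) := Over.mk (U.ι ≫ X.hom)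
  let t : T ⟶ X := Over.homMk U.ι
  have : IsAffine T.left := hU
  have : Nonempty T.left := ⟨⟨x, hx⟩⟩
  have hTX : IsAffine (T ⊗ X).left := by
    have : IsAffine (T ⊗ G).left := inferInstanceAs (IsAffine (pullback T.hom G.hom))
    have : IsIso (a.trivialization t).inv.left :=
      inferInstanceAs (IsIso ((Over.forget _).map (a.trivialization t).inv))
    exact .of_isIso (a.trivialization t).inv.left
  have : Subsingleton (Spec (CommRingCat.of k)) :=
    inferInstanceAs (Subsingleton (PrimeSpectrum k))
  have : Surjective T.hom := ⟨fun s => ⟨Classical.arbitrary _, Subsingleton.elim _ _⟩⟩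
  have : IsAffine (pullback T.hom X.hom) := hTX
  exact isAffine_of_isPullback (IsPullback.of_hasPullback T.hom X.hom).flip

end Affine

/-! ### From affine torsors to Galois extensions -/

namespace RightActionObj

section Preimage

variable {C : Type*} [Category* C] [CartesianMonoidalCategory C] {D : Type*} [Category* D]
  [CartesianMonoidalCategory D] (F : C ⥤ D) [F.Monoidal]

open scoped Obj

open Functor LaxMonoidal

/-- Transport of an action along a fully faithful monoidal functor. -/
noncomputable def preimage (hF : F.FullyFaithful) {G X : C} {G' X' : D} [MonObj G] [MonObj G']
    (a : RightActionObj G' X') (eG : F.obj G ≅ G') [IsMonHom eG.hom] (eX : F.obj X ≅ X') :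
    RightActionObj G X where
  act := hF.preimage (OplaxMonoidal.δ F X G ≫ (eX.hom ⊗ₘ eG.hom) ≫ a.act ≫ eX.inv)
  act_one := hF.map_injective <| by
    have h : F.map (MonObj.one : 𝟙_ C ⟶ G) ≫ eG.hom = OplaxMonoidal.η F ≫ MonObj.one := by
      rw [← IsMonHom.one_hom (f := eG.hom), obj.η_def, Category.assoc, Monoidal.η_ε_assoc]
    have h1 : X' ◁ MonObj.one ≫ a.act ≫ eX.inv = (ρ_ X').hom ≫ eX.inv := by
      rw [← a.act_one, Category.assoc]
    rw [F.map_comp, hF.map_preimage, ← OplaxMonoidal.δ_natural_right_assoc,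
      whiskerLeft_comp_tensorHom_assoc, h, tensorHom_def_assoc,
      MonoidalCategory.whiskerLeft_comp_assoc, h1, ← OplaxMonoidal.right_unitality_hom,
      ← whisker_exchange_assoc, rightUnitor_naturality_assoc, Iso.hom_inv_id, Category.comp_id]
  act_mul := hF.map_injective <| by
    have h : F.map (MonObj.mul : G ⊗ G ⟶ G) ≫ eG.hom =
        OplaxMonoidal.δ F G G ≫ (eG.hom ⊗ₘ eG.hom) ≫ MonObj.mul := by
      rw [← IsMonHom.mul_hom (f := eG.hom), obj.μ_def, Category.assoc, Monoidal.δ_μ_assoc]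
    have h1 : a.act ▷ G' ≫ a.act ≫ eX.inv =
        (α_ X' G' G').hom ≫ X' ◁ MonObj.mul ≫ a.act ≫ eX.inv := by
      rw [reassoc_of% a.act_mul]
    have h2 : (OplaxMonoidal.δ F X G ≫ (eX.hom ⊗ₘ eG.hom) ≫ a.act ≫ eX.inv) ▷ F.obj G ≫
        (eX.hom ⊗ₘ eG.hom) = OplaxMonoidal.δ F X G ▷ F.obj G ≫
          ((eX.hom ⊗ₘ eG.hom) ⊗ₘ eG.hom) ≫ a.act ▷ G' := by
      rw [whiskerRight_comp_tensorHom, tensorHom_comp_whiskerRight, whiskerRight_comp_tensorHom]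
      simp
    rw [F.map_comp, F.map_comp, F.map_comp, hF.map_preimage, ← OplaxMonoidal.δ_natural_left_assoc,
      hF.map_preimage, reassoc_of% h2, h1, ← OplaxMonoidal.δ_natural_right_assoc,
      whiskerLeft_comp_tensorHom_assoc, h, associator_naturality_assoc,
      OplaxMonoidal.associativity_assoc]
    rw [whiskerLeft_comp_tensorHom_assoc, tensorHom_comp_whiskerLeft_assoc]
    simp

/-- Up to structural isomorphisms, `F` sends the new shear map to the old one, and `F` reflects
isomorphisms. -/
theorem isIso_shear_preimage (hF : F.FullyFaithful) {G X : C} {G' X' : D} [MonObj G] [MonObj G']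
    (a : RightActionObj G' X') [IsIso a.shear] (eG : F.obj G ≅ G') [IsMonHom eG.hom]
    (eX : F.obj X ≅ X') : IsIso (a.preimage F hF eG eX).shear := by
  have := hF.reflectsIsomorphisms
  suffices h : IsIso (F.map (a.preimage F hF eG eX).shear) from isIso_of_reflects_iso _ F
  have e : F.map (a.preimage F hF eG eX).shear = OplaxMonoidal.δ F X G ≫ (eX.hom ⊗ₘ eG.hom) ≫
      a.shear ≫ (eX.inv ⊗ₘ eX.inv) ≫ LaxMonoidal.μ F X X := by
    rw [← cancel_mono (OplaxMonoidal.δ F X X)]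
    ext <;> simp [preimage, ← Functor.map_comp, reassoc_of% a.shear_fst, reassoc_of% a.shear_snd]
  rw [e]
  infer_instance

end Preimage

section Algebra

variable {k : Type u} [Field k] {H : Type u} [CommRing H] [HopfAlgebra k H]
  {A : Type u} [CommRing A] [Algebra k A]

open Opposite

/-- The coaction of an action of an affine group scheme on an affine scheme. -/
def comoduleAlgebra (a : RightActionObj (op (CommAlgCat.of k H)) (op (CommAlgCat.of k A))) :
    ComoduleAlgebra k H A where
  coact := a.act.unop.hom
  coassoc x := (AlgEquiv.eq_symm_apply _).1 <| DFunLike.congr_fun congr($(a.act_mul).unop.hom) x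
  counit x := (AlgEquiv.eq_symm_apply _).1 <| DFunLike.congr_fun congr($(a.act_one).unop.hom) x

/-- The Galois map is the shear map read in the opposite category. -/
theorem isGaloisExtension_comoduleAlgebra [Nontrivial A]
    (a : RightActionObj (op (CommAlgCat.of k H)) (op (CommAlgCat.of k A))) [IsIso a.shear] :
    a.comoduleAlgebra.IsGaloisExtension where
  nontrivial := ‹_›
  bijective := by
    have : IsIso a.shear.unop := inferInstance
    have e : a.comoduleAlgebra.galoisMap = a.shear.unop.hom := rfl
    rw [e]
    exact ConcreteCategory.bijective_of_isIso a.shear.unop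

end Algebra

end RightActionObj

section

open AlgebraicGeometry Opposite Functor LaxMonoidal
open scoped Obj

/-- An action of an affine group scheme on an affine scheme comes from a commutative Hopf
algebra. -/
theorem RightActionObj.exists_preimage_algSpec {R : CommRingCat.{u}} {G X : Over (Spec R)}
    [GrpObj G] [IsAffine G.left] [IsAffine X.left] (a : RightActionObj G X) [IsIso a.shear] :
    ∃ (H : CommHopfAlgCat.{u} R) (A : CommAlgCat.{u} R)
      (a' : RightActionObj (op (CommAlgCat.of R H)) (op (CommAlgCat.of R A))),
      IsIso a'.shear ∧ Nonempty ((algSpec R).obj (op (CommAlgCat.of R A)) ≅ X) := by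
  obtain ⟨⟨H⟩, ⟨e⟩⟩ := essImage_hopfSpec (G := .mk G).2 ‹_›
  obtain ⟨⟨A⟩, ⟨eX⟩⟩ := essImage_algSpec.2 ‹IsAffine X.left›
  let eG : (algSpec R).obj (op (CommAlgCat.of R H)) ≅ G := (Grp.forget _).mapIso e
  have : IsMonHom eG.hom := e.hom.hom.isMonHom_hom
  exact ⟨H, A, a.preimage (algSpec R) algSpec.fullyFaithful eG eX,
    a.isIso_shear_preimage _ algSpec.fullyFaithful eG eX, ⟨eX⟩⟩

/-- The rational point of `Spec A` defined by a homomorphism from `A` to the base ring. -/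
noncomputable def CommAlgCat.point {R : CommRingCat.{u}} {A : Type u} [CommRing A] [Algebra R A]
    (f : A →ₐ[R] R) :
    𝟙_ (Over (Spec R)) ⟶ (algSpec R).obj (op (CommAlgCat.of R A)) :=
  LaxMonoidal.ε (algSpec R) ≫ (algSpec R).map (CommAlgCat.ofHom f).op

/-- A torsor under an affine group scheme over an algebraically closed field has a rational
point. -/
theorem IsTorsor.nonempty_point {k : Type u} [Field k] [IsAlgClosed k]
    {G X : Over (Spec (CommRingCat.of k))} [GrpObj G] [IsAffine G.left] {a : RightActionObj G X}
    (ha : IsTorsor a) : Nonempty (𝟙_ (Over (Spec (CommRingCat.of k))) ⟶ X) := by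
  have := ha.isIso_shear
  have := ha.isAffine
  obtain ⟨H, A, a', h, ⟨e⟩⟩ := a.exists_preimage_algSpec
  have : Nontrivial A := by
    obtain ⟨x⟩ := ha.nonempty
    have y : PrimeSpectrum A := e.inv.left x
    exact y.nontrivial
  obtain ⟨f⟩ := (a'.isGaloisExtension_comoduleAlgebra (k := k) (H := H) (A := A)).nonempty_point
  exact ⟨CommAlgCat.point (R := CommRingCat.of k) f ≫ e.hom⟩

end

theorem propositionA1 {k : Type u} [Field k] [IsAlgClosed k] :
    (∀ (H : Type v) [CommRing H] [HopfAlgebra k H]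
        (A : Type w) [CommRing A] [Algebra k A] (ρ : ComoduleAlgebra k H A),
        ρ.IsGaloisExtension → Nonempty (ρ.Iso (ComoduleAlgebra.regular k H))) ∧
    (∀ (G : Over (AlgebraicGeometry.Spec (CommRingCat.of k))) [GrpObj G]
        [AlgebraicGeometry.IsAffine G.left]
        (X : Over (AlgebraicGeometry.Spec (CommRingCat.of k))) (a : RightActionObj G X),
        IsTorsor a → Nonempty (a.Iso (RightActionObj.regular G))) := by
  refine ⟨fun H _ _ A _ _ ρ hρ => ?_, fun G _ _ X a ha => ?_⟩
  · obtain ⟨z⟩ := hρ.nonempty_point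
    exact hρ.nonempty_iso_regular z
  · have := ha.isIso_shear
    obtain ⟨x⟩ := ha.nonempty_point
    exact ⟨a.isoRegularOfPoint x⟩
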